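/- **Setting.** Batanin trees are the finite rooted planar trees $B=\mathrm{br}[B_1,\dots,B_n]$; $\dim B$ is the height of $B$, $\partial_k B$ is obtained by removing all nodes of height more than $k$, and $\mathrm{Pos}(B)$ is the globular set of positions of $B$ (the pasting diagram of shape $B$), with source and target inclusions $s_k^B,t_k^B:\mathrm{Pos}(\partial_kB)\to\mathrm{Pos}(B)$. $D_n$ denotes the tree with $D_0=\mathrm{br}[\,]$, $D_{n+1}=\mathrm{br}[D_n]$. A position of dimension $n$ is *source boundary* (resp. *target boundary*) if it is not the target (resp. source) of an $(n+1)$-position. $\Theta_0$ is the category of Batanin trees and morphisms of globular sets between their positions. *Computads.* A computad $C$ has a set $V_n$ of generators for each $n\ge 0$, each generator of dimension $n+1$ having an $n$-sphere of $C$ as boundary; an $n$-sphere is a pair $(a,b)$ of parallel $n$-cells (same source and target if $n>0$). The $n$-cells are defined inductively: every generator of dimension $n$ is an $n$-cell, and for $n\geq 1$ there is an $n$-cell $\mathrm{coh}(B,A,\tau)$ for every tree $B$ with $\dim B\le n$, every full $(n-1)$-sphere $A=(a,b)$ of the free computad $\mathrm{Free}\,B$ on $\mathrm{Pos}(B)$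 (whose generators are the positions) and every homomorphism $\tau:\mathrm{Free}\,B\to C$; its source and target are $\tau(a)$ and $\tau(b)$. A homomorphism $\tau:D\to C$ sends $n$-dimensional generators to $n$-cells compatibly with boundaries, and acts on cells by $\tau(\mathrm{coh}(B,A,\rho))=\mathrm{coh}(B,A,\tau\rho)$. The top-dimensional support of an $n$-cell is $\{v\}$ for a generator $v$, and the union of those of $\tau(p)$, $p\in\mathrm{Pos}_n(B)$, for $\mathrm{coh}(B,A,\tau)$. An $n$-sphere $(a,b)$ of $\mathrm{Free}\,B$ is *full* if the top-dimensional supports of $a$ and $b$ are the sets of source boundary and target boundary $n$-positions respectively and, if $n>0$, the common boundary sphere of $a$ and $b$ is full. The full *support* of a cell, in all dimensions, consists, for a generator, of the generator itself and the supports of its source and target, and, for $\mathrm{coh}(B,A,\tau)$, of the supports of all $\tau(p)$, $p$ a position of $B$; the support of a homomorphism is the union of the supports of the images of the generators. *Globular theories.* A *globular theory* is a category $\Theta_A$ with a bijective on objects, faithful functor $j_A:\Theta_0\to\Theta_A$ that preserves globular sums, i.e. colimits of diagrams $D_{n_0}\xleftarrow{t}D_{m_1}\xrightarrow{s}D_{n_1}\xleftarrow{t}\cdots\xrightarrow{s}D_{n_r}$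 with $n_{i-1}>m_i<n_i$. Its *immersions* are the morphisms of $\Theta_0$; its *covers* (homogeneous morphisms) are the morphisms $f$ such that whenever $f=i\circ g$ with $i$ an immersion, $i$ is an identity. It is *homogeneous* if every morphism factors uniquely as $f=i\circ c$ with $c$ a cover and $i$ an immersion. A *morphism* of globular theories $\Theta_A\to\Theta_B$ is a functor $S$ with $S j_A=j_B$. Let $\Theta_w$ be the full subcategory of the category of computads on the objects $\mathrm{Free}\,B$, $B$ a Batanin tree, with the evident functor $\Theta_0\to\Theta_w$. Let $\Theta_s$ be the category with objects the Batanin trees and morphisms $B\to B'$ the strict $\omega$-functors between the free strict $\omega$-categories on $\mathrm{Pos}(B)$ and $\mathrm{Pos}(B')$, with the evident functor $\Theta_0\to\Theta_s$. Here the free strict $\omega$-category on a globular set $X$ has as $n$-cells the pairs of a tree $T$ with $\dim T\le n$ and a morphism $\mathrm{Pos}(T)\to X$, with source and target given by restriction along $s_k^T$ and $t_k^T$, and composition along $k$-cells given by gluing pasting diagrams along their common $k$-boundary. **Theorem.** 1. $\Theta_w$ is a homogeneous globular theory: every morphism of $\Theta_w$ factors uniquely as a cover followed by an immersion. Moreover,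 a morphism $\mathrm{Free}\,B\to\mathrm{Free}\,B'$ is a cover if and only if its support consists of all positions of $B'$. 2. $\Theta_s$ is a homogeneous globular theory, and $\Theta_w$ is homogeneous over it: there is a morphism of globular theories $S:\Theta_w\to\Theta_s$ that preserves and reflects covers, i.e. a morphism $f$ of $\Theta_w$ is a cover if and only if $S(f)$ is a cover. -/

import Mathlib

open CategoryTheory

namespace GlobTheory

/-! ### Globular sets -/

/-- A globular set. -/
structure GlobSet where
  cell : ℕ → Type
  src : ∀ {n : ℕ}, cell (n + 1) → cell n
  tgt : ∀ {n : ℕ}, cell (n + 1) → cell n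
  src_src : ∀ {n : ℕ} (x : cell (n + 2)), src (src x) = src (tgt x)
  tgt_src : ∀ {n : ℕ} (x : cell (n + 2)), tgt (src x) = tgt (tgt x)

/-- A morphism of globular sets. -/
@[ext]
structure GlobHom (X Y : GlobSet) where
  app : ∀ n : ℕ, X.cell n → Y.cell n
  app_src : ∀ {n : ℕ} (x : X.cell (n + 1)), app n (X.src x) = Y.src (app (n + 1) x)
  app_tgt : ∀ {n : ℕ} (x : X.cell (n + 1)), app n (X.tgt x) = Y.tgt (app (n + 1) x)

/-- The identity morphism. -/
def GlobHom.id (X : GlobSet) : GlobHom X X where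
  app _ x := x
  app_src _ := rfl
  app_tgt _ := rfl

/-- Composition, in diagrammatic order. -/
def GlobHom.comp {X Y Z : GlobSet} (f : GlobHom X Y) (g : GlobHom Y Z) : GlobHom X Z where
  app n x := g.app n (f.app n x)
  app_src x := by rw [f.app_src, g.app_src]
  app_tgt x := by rw [f.app_tgt, g.app_tgt]

/-! ### Batanin trees and their positions -/

/-- Batanin trees (finite rooted planar trees): `nil` is the tree `br []`, and `cons B L` is the
tree `br [B, B₁, …, Bₙ]` when `L` is the tree `br [B₁, …, Bₙ]`. -/
inductive Bat : Type
  | nil : Bat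
  | cons (B L : Bat) : Bat

/-- The tree `br [B₁, …, Bₙ]` whose root has the branches `B₁, …, Bₙ`. -/
def Bat.br (l : List Bat) : Bat := l.foldr Bat.cons Bat.nil

/-- The dimension (height) of a tree. -/
def Bat.dim : Bat → ℕ
  | .nil => 0
  | .cons B L => max (B.dim + 1) L.dim

/-- `Pos B n` is the set of positions of dimension `n` of the tree `B`. -/
inductive Pos : Bat → ℕ → Type
  | here {B : Bat} : Pos B 0
  | inl {B L : Bat} {n : ℕ} (p : Pos B n) : Pos (.cons B L) (n + 1)
  | inr {B L : Bat} {n : ℕ} (q : Pos L n) : Pos (.cons B L) n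

/-- The source of a position. -/
def Pos.src : {B : Bat} → {n : ℕ} → Pos B (n + 1) → Pos B n
  | _, _, .inr q => .inr q.src
  | _, 0, .inl _ => .here
  | _, _ + 1, .inl p => .inl p.src

/-- The target of a position. -/
def Pos.tgt : {B : Bat} → {n : ℕ} → Pos B (n + 1) → Pos B n
  | _, _, .inr q => .inr q.tgt
  | _, 0, .inl _ => .inr .here
  | _, _ + 1, .inl p => .inl p.tgt

theorem Pos.src_src : ∀ {B : Bat} {n : ℕ} (p : Pos B (n + 2)), p.src.src = p.tgt.src
  | _, n, .inr q => by simp only [Pos.src, Pos.tgt, Pos.src_src q]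
  | _, 0, .inl p => by simp only [Pos.src, Pos.tgt]
  | _, n + 1, .inl p => by simp only [Pos.src, Pos.tgt, Pos.src_src p]

theorem Pos.tgt_src : ∀ {B : Bat} {n : ℕ} (p : Pos B (n + 2)), p.src.tgt = p.tgt.tgt
  | _, n, .inr q => by simp only [Pos.src, Pos.tgt, Pos.tgt_src q]
  | _, 0, .inl p => by simp only [Pos.src, Pos.tgt]
  | _, n + 1, .inl p => by simp only [Pos.src, Pos.tgt, Pos.tgt_src p]

/-- The globular set of positions of a tree (the pasting diagram of shape `B`). -/
def Bat.glob (B : Bat) : GlobSet where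
  cell := Pos B
  src := Pos.src
  tgt := Pos.tgt
  src_src := Pos.src_src
  tgt_src := Pos.tgt_src

/-- The source boundary positions of dimension `n`: those that are not a target. -/
def srcBoundary (B : Bat) (n : ℕ) : Set (Pos B n) := {p | ¬ ∃ q : Pos B (n + 1), q.tgt = p}

/-- The target boundary positions of dimension `n`: those that are not a source. -/
def tgtBoundary (B : Bat) (n : ℕ) : Set (Pos B n) := {p | ¬ ∃ q : Pos B (n + 1), q.src = p}

/-- The `k`-boundary of a tree: all nodes of height more than `k` are removed. -/
def Bat.bd : ℕ → Bat → Bat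
  | 0, .nil => .nil
  | 0, .cons _ _ => .nil
  | _ + 1, .nil => .nil
  | k + 1, .cons B L => .cons (bd k B) (bd (k + 1) L)

theorem Bat.dim_bd_le : ∀ (k : ℕ) (B : Bat), (Bat.bd k B).dim ≤ k
  | 0, .nil => le_refl 0
  | 0, .cons _ _ => le_refl 0
  | _ + 1, .nil => Nat.zero_le _
  | k + 1, .cons B L =>
    max_le (Nat.succ_le_succ (Bat.dim_bd_le k B)) (Bat.dim_bd_le (k + 1) L)

/-- The inclusion of the `k`-boundary as the `k`-source of the pasting diagram, on positions. -/
def srcIncl : (k : ℕ) → (B : Bat) → {n : ℕ} → Pos (B.bd k) n → Pos B n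
  | 0, .nil, _, p => p
  | 0, .cons _ _, _, .here => .here
  | _ + 1, .nil, _, p => p
  | _ + 1, .cons _ _, _, .here => .here
  | k + 1, .cons B _, _, .inl p => .inl (srcIncl k B p)
  | k + 1, .cons _ L, _, .inr q => .inr (srcIncl (k + 1) L q)

/-- The inclusion of the `k`-boundary as the `k`-target of the pasting diagram, on positions. -/
def tgtIncl : (k : ℕ) → (B : Bat) → {n : ℕ} → Pos (B.bd k) n → Pos B n
  | 0, .nil, _, p => p
  | 0, .cons _ L, _, .here => .inr (tgtIncl 0 L .here)
  | _ + 1, .nil, _, p => p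
  | _ + 1, .cons _ _, _, .here => .here
  | k + 1, .cons B _, _, .inl p => .inl (tgtIncl k B p)
  | k + 1, .cons _ L, _, .inr q => .inr (tgtIncl (k + 1) L q)

theorem srcIncl_here (k : ℕ) (B : Bat) : srcIncl k B .here = .here := by
  cases k <;> cases B <;> rfl

theorem tgtIncl_here (k : ℕ) (B : Bat) : tgtIncl (k + 1) B .here = .here := by
  cases B <;> rfl

theorem srcIncl_src : ∀ (k : ℕ) (B : Bat) {n : ℕ} (p : Pos (B.bd k) (n + 1)),
    srcIncl k B p.src = (srcIncl k B p).src
  | 0, .nil, _, p => nomatch p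
  | 0, .cons _ _, _, p => nomatch p
  | _ + 1, .nil, _, _ => rfl
  | _ + 1, .cons _ _, 0, .inl _ => rfl
  | k + 1, .cons B _, _ + 1, .inl p => congrArg Pos.inl (srcIncl_src k B p)
  | k + 1, .cons _ L, _, .inr q => congrArg Pos.inr (srcIncl_src (k + 1) L q)

theorem srcIncl_tgt : ∀ (k : ℕ) (B : Bat) {n : ℕ} (p : Pos (B.bd k) (n + 1)),
    srcIncl k B p.tgt = (srcIncl k B p).tgt
  | 0, .nil, _, p => nomatch p
  | 0, .cons _ _, _, p => nomatch p
  | _ + 1, .nil, _, _ => rfl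
  | k + 1, .cons _ L, 0, .inl _ => congrArg Pos.inr (srcIncl_here (k + 1) L)
  | k + 1, .cons B _, _ + 1, .inl p => congrArg Pos.inl (srcIncl_tgt k B p)
  | k + 1, .cons _ L, _, .inr q => congrArg Pos.inr (srcIncl_tgt (k + 1) L q)

theorem tgtIncl_src : ∀ (k : ℕ) (B : Bat) {n : ℕ} (p : Pos (B.bd k) (n + 1)),
    tgtIncl k B p.src = (tgtIncl k B p).src
  | 0, .nil, _, p => nomatch p
  | 0, .cons _ _, _, p => nomatch p
  | _ + 1, .nil, _, _ => rfl
  | _ + 1, .cons _ _, 0, .inl _ => rfl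
  | k + 1, .cons B _, _ + 1, .inl p => congrArg Pos.inl (tgtIncl_src k B p)
  | k + 1, .cons _ L, _, .inr q => congrArg Pos.inr (tgtIncl_src (k + 1) L q)

theorem tgtIncl_tgt : ∀ (k : ℕ) (B : Bat) {n : ℕ} (p : Pos (B.bd k) (n + 1)),
    tgtIncl k B p.tgt = (tgtIncl k B p).tgt
  | 0, .nil, _, p => nomatch p
  | 0, .cons _ _, _, p => nomatch p
  | _ + 1, .nil, _, _ => rfl
  | k + 1, .cons _ L, 0, .inl _ => congrArg Pos.inr (tgtIncl_here k L)
  | k + 1, .cons B _, _ + 1, .inl p => congrArg Pos.inl (tgtIncl_tgt k B p)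
  | k + 1, .cons _ L, _, .inr q => congrArg Pos.inr (tgtIncl_tgt (k + 1) L q)

/-- The source inclusion `s_k^B` as a morphism of globular sets. -/
def Bat.sInc (k : ℕ) (B : Bat) : GlobHom (B.bd k).glob B.glob where
  app _ := srcIncl k B
  app_src := srcIncl_src k B
  app_tgt := srcIncl_tgt k B

/-- The target inclusion `t_k^B` as a morphism of globular sets. -/
def Bat.tInc (k : ℕ) (B : Bat) : GlobHom (B.bd k).glob B.glob where
  app _ := tgtIncl k B
  app_src := tgtIncl_src k B
  app_tgt := tgtIncl_tgt k B

theorem srcIncl_srcIncl : ∀ (k : ℕ) (B : Bat) {n : ℕ} (p : Pos ((B.bd (k + 1)).bd k) n),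
    srcIncl (k + 1) B (srcIncl k (B.bd (k + 1)) p) =
      tgtIncl (k + 1) B (srcIncl k (B.bd (k + 1)) p)
  | 0, .nil, _, _ => rfl
  | 0, .cons _ _, _, .here => rfl
  | _ + 1, .nil, _, _ => rfl
  | _ + 1, .cons _ _, _, .here => rfl
  | k + 1, .cons B _, _, .inl p => congrArg Pos.inl (srcIncl_srcIncl k B p)
  | k + 1, .cons _ L, _, .inr q => congrArg Pos.inr (srcIncl_srcIncl (k + 1) L q)

theorem srcIncl_tgtIncl : ∀ (k : ℕ) (B : Bat) {n : ℕ} (p : Pos ((B.bd (k + 1)).bd k) n),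
    srcIncl (k + 1) B (tgtIncl k (B.bd (k + 1)) p) =
      tgtIncl (k + 1) B (tgtIncl k (B.bd (k + 1)) p)
  | 0, .nil, _, _ => rfl
  | 0, .cons _ L, _, .here => congrArg Pos.inr (srcIncl_tgtIncl 0 L .here)
  | _ + 1, .nil, _, _ => rfl
  | _ + 1, .cons _ _, _, .here => rfl
  | k + 1, .cons B _, _, .inl p => congrArg Pos.inl (srcIncl_tgtIncl k B p)
  | k + 1, .cons _ L, _, .inr q => congrArg Pos.inr (srcIncl_tgtIncl (k + 1) L q)

/-- The globe `D_n`. -/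
def globe : ℕ → Bat
  | 0 => .nil
  | n + 1 => .cons (globe n) .nil

/-- The (iterated) source inclusion `D_m → D_n` for `m ≤ n`, on positions. -/
def cosrcPos : (m n : ℕ) → m ≤ n → {k : ℕ} → Pos (globe m) k → Pos (globe n) k
  | 0, _, _, _, .here => .here
  | _ + 1, _ + 1, _, _, .here => .here
  | m + 1, n + 1, h, _, .inl p => .inl (cosrcPos m n (Nat.le_of_succ_le_succ h) p)
  | _ + 1, _ + 1, _, _, .inr q => .inr q

/-- The (iterated) target inclusion `D_m → D_n` for `m ≤ n`, on positions. -/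
def cotgtPos : (m n : ℕ) → m ≤ n → {k : ℕ} → Pos (globe m) k → Pos (globe n) k
  | 0, 0, _, _, p => p
  | 0, _ + 1, _, _, .here => .inr .here
  | _ + 1, _ + 1, _, _, .here => .here
  | m + 1, n + 1, h, _, .inl p => .inl (cotgtPos m n (Nat.le_of_succ_le_succ h) p)
  | _ + 1, _ + 1, _, _, .inr q => .inr q

theorem cosrcPos_src : ∀ (m n : ℕ) (h : m ≤ n) {k : ℕ} (p : Pos (globe m) (k + 1)),
    cosrcPos m n h p.src = (cosrcPos m n h p).src
  | _ + 1, _ + 1, _, 0, .inl _ => rfl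
  | m + 1, n + 1, h, _ + 1, .inl p =>
    congrArg Pos.inl (cosrcPos_src m n (Nat.le_of_succ_le_succ h) p)
  | _ + 1, _ + 1, _, _, .inr _ => rfl

theorem cosrcPos_tgt : ∀ (m n : ℕ) (h : m ≤ n) {k : ℕ} (p : Pos (globe m) (k + 1)),
    cosrcPos m n h p.tgt = (cosrcPos m n h p).tgt
  | _ + 1, _ + 1, _, 0, .inl _ => rfl
  | m + 1, n + 1, h, _ + 1, .inl p =>
    congrArg Pos.inl (cosrcPos_tgt m n (Nat.le_of_succ_le_succ h) p)
  | _ + 1, _ + 1, _, _, .inr _ => rfl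

theorem cotgtPos_src : ∀ (m n : ℕ) (h : m ≤ n) {k : ℕ} (p : Pos (globe m) (k + 1)),
    cotgtPos m n h p.src = (cotgtPos m n h p).src
  | _ + 1, _ + 1, _, 0, .inl _ => rfl
  | m + 1, n + 1, h, _ + 1, .inl p =>
    congrArg Pos.inl (cotgtPos_src m n (Nat.le_of_succ_le_succ h) p)
  | _ + 1, _ + 1, _, _, .inr _ => rfl

theorem cotgtPos_tgt : ∀ (m n : ℕ) (h : m ≤ n) {k : ℕ} (p : Pos (globe m) (k + 1)),
    cotgtPos m n h p.tgt = (cotgtPos m n h p).tgt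
  | _ + 1, _ + 1, _, 0, .inl _ => rfl
  | m + 1, n + 1, h, _ + 1, .inl p =>
    congrArg Pos.inl (cotgtPos_tgt m n (Nat.le_of_succ_le_succ h) p)
  | _ + 1, _ + 1, _, _, .inr _ => rfl

/-! ### The category `Θ₀` and globular theories -/

/-- The category `Θ₀`: its objects are the Batanin trees, its morphisms are the morphisms between
their globular sets of positions. -/
def Theta0 : Type := Bat

instance : Category Theta0 where
  Hom B C := GlobHom (Bat.glob B) (Bat.glob C)
  id B := GlobHom.id (Bat.glob B)
  comp f g := GlobHom.comp f g

/-- The globe `D_n` as an object of `Θ₀`. -/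
def Theta0.globe (n : ℕ) : Theta0 := GlobTheory.globe n

/-- The (iterated) source inclusion `D_m ⟶ D_n`. -/
def cosrc {m n : ℕ} (h : m ≤ n) : Theta0.globe m ⟶ Theta0.globe n where
  app _ := cosrcPos m n h
  app_src := cosrcPos_src m n h
  app_tgt := cosrcPos_tgt m n h

/-- The (iterated) target inclusion `D_m ⟶ D_n`. -/
def cotgt {m n : ℕ} (h : m ≤ n) : Theta0.globe m ⟶ Theta0.globe n where
  app _ := cotgtPos m n h
  app_src := cotgtPos_src m n h
  app_tgt := cotgtPos_tgt m n h

/-- A table of dimensions `n₀ > m₁ < n₁ > ⋯ < n_r`, the shape of a globular sum. -/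
structure DimTable where
  r : ℕ
  top : Fin (r + 1) → ℕ
  bot : Fin r → ℕ
  lt_left : ∀ i : Fin r, bot i < top i.castSucc
  lt_right : ∀ i : Fin r, bot i < top i.succ

section Theories

universe v u

variable {A : Type u} [Category.{v} A]

/-- A cocone with vertex `Z` under the diagram
`D_{n₀} ← D_{m₁} → D_{n₁} ← ⋯ → D_{n_r}` of target and source inclusions in `A`. -/
def IsGlobCocone (j : Theta0 ⥤ A) (G : DimTable) (Z : A)
    (a : ∀ i : Fin (G.r + 1), j.obj (Theta0.globe (G.top i)) ⟶ Z) : Prop :=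
  ∀ i : Fin G.r, j.map (cotgt (G.lt_left i).le) ≫ a i.castSucc =
    j.map (cosrc (G.lt_right i).le) ≫ a i.succ

/-- A globular sum in `A`: a colimit cocone under such a diagram. -/
def IsGlobSum (j : Theta0 ⥤ A) (G : DimTable) (Z : A)
    (a : ∀ i : Fin (G.r + 1), j.obj (Theta0.globe (G.top i)) ⟶ Z) : Prop :=
  IsGlobCocone j G Z a ∧
    ∀ (W : A) (b : ∀ i : Fin (G.r + 1), j.obj (Theta0.globe (G.top i)) ⟶ W),
      IsGlobCocone j G W b → ∃! h : Z ⟶ W, ∀ i, a i ≫ h = b i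

/-- A globular theory: a bijective on objects, faithful functor out of `Θ₀` that preserves
globular sums. -/
structure IsGlobularTheory (j : Theta0 ⥤ A) : Prop where
  bijective_obj : Function.Bijective j.obj
  faithful : j.Faithful
  preserves_sums : ∀ (G : DimTable) (Z : Theta0)
    (a : ∀ i : Fin (G.r + 1), Theta0.globe (G.top i) ⟶ Z),
    IsGlobSum (𝟭 Theta0) G Z a → IsGlobSum j G (j.obj Z) (fun i => j.map (a i))

/-- The immersions of a globular theory: the morphisms of `Θ₀`. -/
def IsImmersion (j : Theta0 ⥤ A) {X Y : A} (f : X ⟶ Y) : Prop :=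
  ∃ (B C : Theta0) (i : B ⟶ C), Arrow.mk (j.map i) = Arrow.mk f

/-- The covers (homogeneous morphisms) of a globular theory: the morphisms `f` such that, whenever
`f = i ∘ g` with `i` an immersion, `i` is an identity. -/
def IsCover (j : Theta0 ⥤ A) {X Y : A} (f : X ⟶ Y) : Prop :=
  ∀ ⦃Z : A⦄ (g : X ⟶ Z) (i : Z ⟶ Y), IsImmersion j i → g ≫ i = f →
    ∃ h : Z = Y, i = eqToHom h

/-- A homogeneous globular theory: a globular theory in which every morphism factors uniquely as a
cover followed by an immersion. -/
structure IsHomogeneous (j : Theta0 ⥤ A) : Prop where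
  isGlobularTheory : IsGlobularTheory j
  existsUnique_fac : ∀ {X Y : A} (f : X ⟶ Y),
    ∃! t : (Z : A) × (X ⟶ Z) × (Z ⟶ Y),
      IsCover j t.2.1 ∧ IsImmersion j t.2.2 ∧ t.2.1 ≫ t.2.2 = f

end Theories

/-! ### Computads -/

/-- Raw cells over a family of generators: `var v` is a generator, and `coh B a b τ` is the
coherence cell over the tree `B` with sphere `(a, b)`, precomposed with `τ`. The cells of a computad
are the raw cells satisfying `IsCell` below. -/
inductive RawCell : (ℕ → Type) → ℕ → Type 1
  | var {V : ℕ → Type} {n : ℕ} (v : V n) : RawCell V n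
  | coh {V : ℕ → Type} {n : ℕ} (B : Bat) (a b : RawCell (Pos B) n)
      (τ : ∀ k : ℕ, Pos B k → RawCell V k) : RawCell V (n + 1)

namespace RawCell

/-- The action on cells of an assignment of cells to generators. -/
def subst {V W : ℕ → Type} (σ : ∀ k : ℕ, V k → RawCell W k) :
    {n : ℕ} → RawCell V n → RawCell W n
  | _, .var v => σ _ v
  | _, .coh B a b τ => .coh B a b (fun k p => subst σ (τ k p))

/-- The set of generators of dimension `n` that appear in an `n`-cell. -/
def fv {V : ℕ → Type} : {n : ℕ} → RawCell V n → Set (V n)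
  | _, .var v => {v}
  | n + 1, .coh B _ _ τ => ⋃ p : Pos B (n + 1), fv (τ (n + 1) p)

theorem subst_var {V : ℕ → Type} {n : ℕ} (c : RawCell V n) :
    c.subst (fun _ v => RawCell.var v) = c := by
  induction c with
  | var v => rfl
  | coh B a b τ _ _ ih => simp only [subst, ih]

theorem subst_subst {V W U : ℕ → Type} (σ : ∀ k : ℕ, V k → RawCell W k)
    (ρ : ∀ k : ℕ, W k → RawCell U k) {n : ℕ} (c : RawCell V n) :
    (c.subst σ).subst ρ = c.subst (fun k v => (σ k v).subst ρ) := by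
  induction c with
  | var v => rfl
  | coh B a b τ _ _ ih => simp only [subst, ih]

end RawCell

/-- Families of generators, each generator of positive dimension having a source and a target. -/
structure PreComputad where
  V : ℕ → Type
  s : ∀ {n : ℕ}, V (n + 1) → RawCell V n
  t : ∀ {n : ℕ}, V (n + 1) → RawCell V n

namespace PreComputad

/-- The source of a cell; that of `coh B a b τ` is the image of `a` under `τ`. -/
def src (C : PreComputad) {n : ℕ} : RawCell C.V (n + 1) → RawCell C.V n
  | .var v => C.s v
  | .coh _ a _ τ => a.subst τ

/-- The target of a cell; that of `coh B a b τ` is the image of `b` under `τ`. -/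
def tgt (C : PreComputad) {n : ℕ} : RawCell C.V (n + 1) → RawCell C.V n
  | .var v => C.t v
  | .coh _ _ b τ => b.subst τ

/-- Two cells are parallel when they have the same boundary; `n`-spheres are parallel pairs of
`n`-cells. -/
def Parallel (C : PreComputad) : {n : ℕ} → RawCell C.V n → RawCell C.V n → Prop
  | 0, _, _ => True
  | _ + 1, a, b => C.src a = C.src b ∧ C.tgt a = C.tgt b

/-- The generators and boundaries of the free computad on a globular set. -/
def free (X : GlobSet) : PreComputad where
  V := X.cell
  s x := .var (X.src x)
  t x := .var (X.tgt x)

end PreComputad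

/-- Fullness of an `n`-sphere `(a, b)` of the free computad on a tree `B`: the support of `a`
consists of the source boundary positions, that of `b` of the target boundary positions, and the
common boundary of `a` and `b` is full. (In dimension `0`, `a` and `b` are positions and the
condition says that `a` is source boundary and `b` is target boundary.) -/
def IsFull (B : Bat) : (n : ℕ) → RawCell (Pos B) n → RawCell (Pos B) n → Prop
  | 0, a, b => a.fv ⊆ srcBoundary B 0 ∧ b.fv ⊆ tgtBoundary B 0
  | n + 1, a, b => a.fv = srcBoundary B (n + 1) ∧ b.fv = tgtBoundary B (n + 1) ∧
      IsFull B n ((PreComputad.free B.glob).src a) ((PreComputad.free B.glob).tgt a)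

/-- The cells of a computad: generators, and coherence cells `coh B a b τ` of dimension `n + 1`
where `dim B ≤ n + 1`, `(a, b)` is a full `n`-sphere of the free computad on `B`, and `τ` is a
homomorphism from the free computad on `B`. -/
inductive IsCell : (C : PreComputad) → {n : ℕ} → RawCell C.V n → Prop
  | var {C : PreComputad} {n : ℕ} (v : C.V n) : IsCell C (.var v)
  | coh {C : PreComputad} {n : ℕ} (B : Bat) (a b : RawCell (Pos B) n)
      (τ : ∀ k : ℕ, Pos B k → RawCell C.V k)
      (dim_le : B.dim ≤ n + 1)
      (cell_left : IsCell (PreComputad.free B.glob) a)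
      (cell_right : IsCell (PreComputad.free B.glob) b)
      (parallel : (PreComputad.free B.glob).Parallel a b)
      (full : IsFull B n a b)
      (cell_app : ∀ (k : ℕ) (p : Pos B k), IsCell C (τ k p))
      (src_app : ∀ (k : ℕ) (p : Pos B (k + 1)), C.src (τ (k + 1) p) = τ k p.src)
      (tgt_app : ∀ (k : ℕ) (p : Pos B (k + 1)), C.tgt (τ (k + 1) p) = τ k p.tgt) :
      IsCell C (.coh B a b τ)

/-- A computad: every generator of dimension `n + 1` has an `n`-sphere as its boundary. -/
structure Computad extends PreComputad where
  s_isCell : ∀ {n : ℕ} (v : V (n + 1)), IsCell toPreComputad (s v)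
  t_isCell : ∀ {n : ℕ} (v : V (n + 1)), IsCell toPreComputad (t v)
  parallel : ∀ {n : ℕ} (v : V (n + 1)), toPreComputad.Parallel (s v) (t v)

/-- A homomorphism of computads sends generators to cells, compatibly with boundaries. -/
@[ext]
structure Computad.Hom (C D : Computad) where
  app : ∀ n : ℕ, C.V n → RawCell D.V n
  isCell : ∀ {n : ℕ} (v : C.V n), IsCell D.toPreComputad (app n v)
  src_app : ∀ {n : ℕ} (v : C.V (n + 1)), D.src (app (n + 1) v) = (C.s v).subst app
  tgt_app : ∀ {n : ℕ} (v : C.V (n + 1)), D.tgt (app (n + 1) v) = (C.t v).subst app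

namespace Computad

theorem Hom.src_subst {C D : Computad} (σ : Hom C D) {n : ℕ} (c : RawCell C.V (n + 1)) :
    D.src (c.subst σ.app) = (C.src c).subst σ.app := by
  cases c with
  | var v => exact σ.src_app v
  | coh B a b τ => exact (RawCell.subst_subst _ _ _).symm

theorem Hom.tgt_subst {C D : Computad} (σ : Hom C D) {n : ℕ} (c : RawCell C.V (n + 1)) :
    D.tgt (c.subst σ.app) = (C.tgt c).subst σ.app := by
  cases c with
  | var v => exact σ.tgt_app v
  | coh B a b τ => exact (RawCell.subst_subst _ _ _).symm

theorem isCell_subst_aux {P : PreComputad} {n : ℕ} {c : RawCell P.V n} (hc : IsCell P c) :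
    ∀ {C D : Computad} (h : C.toPreComputad = P) (σ : Hom C D),
      IsCell D.toPreComputad ((h ▸ c : RawCell C.V n).subst σ.app) := by
  induction hc with
  | var v => intro C D h σ; subst h; exact σ.isCell v
  | coh B a b τ h1 h2 h3 h4 h5 _ h7 h8 _ _ ih =>
    intro C D h σ
    subst h
    refine IsCell.coh B a b _ h1 h2 h3 h4 h5 (fun k p => ih k p rfl σ) ?_ ?_
    · intro k p
      rw [Hom.src_subst, h7]
    · intro k p
      rw [Hom.tgt_subst, h8]

theorem Hom.isCell_subst {C D : Computad} (σ : Hom C D) {n : ℕ} {c : RawCell C.V n}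
    (hc : IsCell C.toPreComputad c) : IsCell D.toPreComputad (c.subst σ.app) :=
  isCell_subst_aux hc rfl σ

/-- The identity homomorphism. -/
def Hom.id (C : Computad) : Hom C C where
  app _ v := .var v
  isCell v := IsCell.var v
  src_app _ := (RawCell.subst_var _).symm
  tgt_app _ := (RawCell.subst_var _).symm

/-- Composition, in diagrammatic order. -/
def Hom.comp {C D E : Computad} (σ : Hom C D) (ρ : Hom D E) : Hom C E where
  app n v := (σ.app n v).subst ρ.app
  isCell v := ρ.isCell_subst (σ.isCell v)
  src_app v := by rw [Hom.src_subst, σ.src_app, RawCell.subst_subst]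
  tgt_app v := by rw [Hom.tgt_subst, σ.tgt_app, RawCell.subst_subst]

/-- The category of computads. -/
instance : Category Computad where
  Hom := Computad.Hom
  id := Hom.id
  comp := Hom.comp
  id_comp _ := rfl
  comp_id σ := Hom.ext (funext fun n => funext fun v => RawCell.subst_var (σ.app n v))
  assoc σ ρ π :=
    Hom.ext (funext fun n => funext fun v => RawCell.subst_subst ρ.app π.app (σ.app n v))

/-- The free computad on a globular set. -/
def free (X : GlobSet) : Computad where
  toPreComputad := PreComputad.free X
  s_isCell x := IsCell.var (C := PreComputad.free X) (X.src x)
  t_isCell x := IsCell.var (C := PreComputad.free X) (X.tgt x)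
  parallel {n} x := by
    cases n with
    | zero => trivial
    | succ n =>
      exact ⟨congrArg RawCell.var (X.src_src x), congrArg RawCell.var (X.tgt_src x)⟩

/-- The homomorphism of free computads induced by a morphism of globular sets. -/
def freeMap {X Y : GlobSet} (f : GlobHom X Y) : free X ⟶ free Y where
  app n x := .var (f.app n x)
  isCell x := IsCell.var (C := PreComputad.free Y) (f.app _ x)
  src_app x := congrArg RawCell.var (f.app_src x).symm
  tgt_app x := congrArg RawCell.var (f.app_tgt x).symm

/-- `InSupport C w c`: the generator `w` (of any dimension) lies in the support of the cell `c`. The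
support of a generator consists of itself and the supports of its source and target; that of
`coh B a b τ` is the union of the supports of the cells `τ p` over all positions `p` of `B`. -/
inductive InSupport (C : Computad) {k : ℕ} (w : C.V k) : {n : ℕ} → RawCell C.V n → Prop
  | self : InSupport C w (.var w)
  | src {n : ℕ} (v : C.V (n + 1)) : InSupport C w (C.s v) → InSupport C w (.var v)
  | tgt {n : ℕ} (v : C.V (n + 1)) : InSupport C w (C.t v) → InSupport C w (.var v)
  | coh {n : ℕ} (B : Bat) (a b : RawCell (Pos B) n) (τ : ∀ k : ℕ, Pos B k → RawCell C.V k)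
      (m : ℕ) (p : Pos B m) : InSupport C w (τ m p) → InSupport C w (.coh B a b τ)

/-- A homomorphism whose support consists of all generators of its target. -/
def Hom.HasFullSupport {C D : Computad} (σ : Hom C D) : Prop :=
  ∀ (k : ℕ) (w : D.V k), ∃ (n : ℕ) (v : C.V n), InSupport D w (σ.app n v)

end Computad

/-! ### The theory `Θ_w` -/

/-- The category `Θ_w`: the full subcategory of the category of computads on the computads that are
free on (the globular set of positions of) a Batanin tree. -/
def ThetaW : Type := Bat

instance : Category ThetaW where
  Hom B C := Computad.free (Bat.glob B) ⟶ Computad.free (Bat.glob C)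
  id B := 𝟙 (Computad.free (Bat.glob B))
  comp f g := CategoryStruct.comp (obj := Computad) f g
  id_comp f := Category.id_comp (obj := Computad) f
  comp_id f := Category.comp_id (obj := Computad) f
  assoc f g h := Category.assoc (obj := Computad) f g h

/-- The inclusion `Θ₀ ⥤ Θ_w`. -/
def inclW : Theta0 ⥤ ThetaW where
  obj B := B
  map f := Computad.freeMap f
  map_id _ := rfl
  map_comp _ _ := rfl

/-! ### Strict `ω`-categories generated by globular sets, and the theory `Θ_s` -/

/-- The `n`-cells of the free strict `ω`-category on a globular set `X`: pasting diagrams of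
dimension at most `n` labelled in `X`. -/
@[ext]
structure StrictCell (X : GlobSet) (n : ℕ) where
  tree : Bat
  dim_le : tree.dim ≤ n
  map : GlobHom tree.glob X

namespace StrictCell

variable {X : GlobSet}

/-- The `k`-dimensional source of a cell. -/
def srcAt (k : ℕ) {n : ℕ} (x : StrictCell X n) : StrictCell X k where
  tree := x.tree.bd k
  dim_le := Bat.dim_bd_le k x.tree
  map := (x.tree.sInc k).comp x.map

/-- The `k`-dimensional target of a cell. -/
def tgtAt (k : ℕ) {n : ℕ} (x : StrictCell X n) : StrictCell X k where
  tree := x.tree.bd k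
  dim_le := Bat.dim_bd_le k x.tree
  map := (x.tree.tInc k).comp x.map

/-- The identity `(n+1)`-cell on an `n`-cell. -/
def ident {n : ℕ} (x : StrictCell X n) : StrictCell X (n + 1) where
  tree := x.tree
  dim_le := Nat.le_succ_of_le x.dim_le
  map := x.map

end StrictCell

/-- The underlying globular set of the free strict `ω`-category on `X`. -/
def strictFree (X : GlobSet) : GlobSet where
  cell := StrictCell X
  src {n} x := x.srcAt n
  tgt {n} x := x.tgtAt n
  src_src {n} x := by
    have : ((x.tree.bd (n + 1)).sInc n).comp ((x.tree.sInc (n + 1)).comp x.map) =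
        ((x.tree.bd (n + 1)).sInc n).comp ((x.tree.tInc (n + 1)).comp x.map) :=
      GlobHom.ext (funext fun l => funext fun p =>
        congrArg (x.map.app l) (srcIncl_srcIncl n x.tree p))
    simp only [StrictCell.srcAt, StrictCell.tgtAt, this]
  tgt_src {n} x := by
    have : ((x.tree.bd (n + 1)).tInc n).comp ((x.tree.sInc (n + 1)).comp x.map) =
        ((x.tree.bd (n + 1)).tInc n).comp ((x.tree.tInc (n + 1)).comp x.map) :=
      GlobHom.ext (funext fun l => funext fun p =>
        congrArg (x.map.app l) (srcIncl_tgtIncl n x.tree p))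
    simp only [StrictCell.srcAt, StrictCell.tgtAt, this]

/-- The tree obtained by gluing the `k`-target of `B` to the `k`-source of `C`, when `B` and `C` have
the same `k`-boundary: for `k = 0` the lists of branches are concatenated, for `k > 0` corresponding
branches are glued along dimension `k - 1`. -/
def Bat.glue : ℕ → Bat → Bat → Bat
  | 0, .nil, C => C
  | 0, .cons B L, C => .cons B (glue 0 L C)
  | _ + 1, .nil, C => C
  | _ + 1, .cons B L, .nil => .cons B L
  | k + 1, .cons B L, .cons C M => .cons (glue k B C) (glue (k + 1) L M)

/-- The inclusion of the first tree into the glued tree, on positions. -/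
def glueLeft : (k : ℕ) → (B C : Bat) → {n : ℕ} → Pos B n → Pos (Bat.glue k B C) n
  | 0, .nil, _, _, .here => .here
  | 0, .cons _ _, _, _, .here => .here
  | 0, .cons _ _, _, _, .inl p => .inl p
  | 0, .cons _ L, C, _, .inr q => .inr (glueLeft 0 L C q)
  | _ + 1, .nil, _, _, .here => .here
  | _ + 1, .cons _ _, .nil, _, p => p
  | _ + 1, .cons _ _, .cons _ _, _, .here => .here
  | k + 1, .cons B _, .cons C _, _, .inl p => .inl (glueLeft k B C p)
  | k + 1, .cons _ L, .cons _ M, _, .inr q => .inr (glueLeft (k + 1) L M q)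

/-- The inclusion of the second tree into the glued tree, on positions. -/
def glueRight : (k : ℕ) → (B C : Bat) → {n : ℕ} → Pos C n → Pos (Bat.glue k B C) n
  | 0, .nil, _, _, p => p
  | 0, .cons _ L, C, _, p => .inr (glueRight 0 L C p)
  | _ + 1, .nil, _, _, p => p
  | _ + 1, .cons _ _, .nil, _, .here => .here
  | _ + 1, .cons _ _, .cons _ _, _, .here => .here
  | k + 1, .cons B _, .cons C _, _, .inl p => .inl (glueRight k B C p)
  | k + 1, .cons _ L, .cons _ M, _, .inr q => .inr (glueRight (k + 1) L M q)

/-- `z` is the composite of the `n`-cells `x` and `y` along their common `k`-cell: the `k`-target of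
`x` is the `k`-source of `y`, and `z` is the labelling of the glued tree that restricts to `x` and to
`y`. -/
def IsComposite {X : GlobSet} (k : ℕ) {n : ℕ} (x y z : StrictCell X n) : Prop :=
  x.tgtAt k = y.srcAt k ∧
    ∃ (hd : (Bat.glue k x.tree y.tree).dim ≤ n) (h : GlobHom (Bat.glue k x.tree y.tree).glob X),
      (∀ (l : ℕ) (p : Pos x.tree l), h.app l (glueLeft k x.tree y.tree p) = x.map.app l p) ∧
      (∀ (l : ℕ) (p : Pos y.tree l), h.app l (glueRight k x.tree y.tree p) = y.map.app l p) ∧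
      z = ⟨Bat.glue k x.tree y.tree, hd, h⟩

/-- A strict `ω`-functor between free strict `ω`-categories: a morphism of globular sets that
preserves identities and composites. -/
@[ext]
structure StrictFunctor (X Y : GlobSet) where
  hom : GlobHom (strictFree X) (strictFree Y)
  map_ident : ∀ {n : ℕ} (x : StrictCell X n), hom.app (n + 1) x.ident = (hom.app n x).ident
  map_composite : ∀ {k n : ℕ}, k < n → ∀ x y z : StrictCell X n, IsComposite k x y z →
    IsComposite k (hom.app n x) (hom.app n y) (hom.app n z)

/-- The category `Θ_s`: its objects are the Batanin trees, its morphisms are the strict `ω`-functors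
between the strict `ω`-categories that they generate. -/
def ThetaS : Type := Bat

instance : Category ThetaS where
  Hom B C := StrictFunctor (Bat.glob B) (Bat.glob C)
  id B :=
    { hom := GlobHom.id _
      map_ident := fun _ => rfl
      map_composite := fun _ _ _ _ h => h }
  comp f g :=
    { hom := f.hom.comp g.hom
      map_ident := fun x => by
        show g.hom.app _ (f.hom.app _ x.ident) = (g.hom.app _ (f.hom.app _ x)).ident
        rw [f.map_ident]
        exact g.map_ident _
      map_composite := fun hk x y z h =>
        g.map_composite hk _ _ _ (f.map_composite hk x y z h) }

/-- The strict `ω`-functor induced by a morphism of globular sets: it relabels pasting diagrams. -/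
def strictFreeMap {X Y : GlobSet} (f : GlobHom X Y) : StrictFunctor X Y where
  hom :=
    { app := fun _ x => ⟨x.tree, x.dim_le, x.map.comp f⟩
      app_src := fun _ => rfl
      app_tgt := fun _ => rfl }
  map_ident _ := rfl
  map_composite := by
    rintro k n - x y z ⟨hxy, hd, h, hl, hr, rfl⟩
    refine ⟨?_, hd, h.comp f, fun l p => congrArg (f.app l) (hl l p),
      fun l p => congrArg (f.app l) (hr l p), rfl⟩
    exact congrArg
      (fun w : StrictCell X k => (⟨w.tree, w.dim_le, w.map.comp f⟩ : StrictCell Y k)) hxy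

/-- The inclusion `Θ₀ ⥤ Θ_s`. -/
def inclS : Theta0 ⥤ ThetaS where
  obj B := B
  map f := strictFreeMap f
  map_id _ := rfl
  map_comp _ _ := rfl

end GlobTheory

namespace GlobTheory

/-! ### Elementary facts on positions -/

/-! Everything rests on the rigidity of trees. A morphism between trees is injective, and its image
determines it, domain included (`GlobHom.injective`, `GlobHom.eq_of_range_eq`). Hence an `n`-cell of
the free strict ω-category on a tree `C` amounts to its support, a set of positions of `C` that is
the image of a tree of height at most `n` (`StrictCell.supp_injective`). In these terms sources and
targets become the set operation `PosSet.bd`, and composition becomes union, because gluing of trees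
is a pushout. A globular map from the positions of `B` to strict cells over `C` therefore extends to
a strict functor by taking unions of supports (`extend`), and in only one way
(`StrictFunctor.ext_gen`).

Homogeneity is then formal. The support of a morphism is the image of a tree `T` in `C`; the
morphism factors through this immersion, the remaining factor has full support, and rigidity makes
the factorization unique. `SupportData` isolates what this argument uses, and it also shows that the
covers are the morphisms of full support.

For `Θ_w` the substance is that the support of a weak cell is again the image of a tree, and that
the supports of its source and target are obtained by `PosSet.bd` (`IsCell.isPasting`). Fullness is
what makes this work: the two cells of a full sphere over `B` have exactly the source and the target
boundary of `B` as supports (`IsFull.supp_eq`). So `coh B a b τ` has the support, boundaries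
included, of the strict cell obtained by extending the supports of `τ` and evaluating at the top
cell of `B`. Replacing each weak cell by the strict cell with the same support gives `strictify`;
since it keeps supports, it preserves and reflects covers.

Globular sums in `Θ₀` are computed position by position (`IsGlobSum.isPosSum`), so cocones into
either theory descend generator by generator. -/

theorem Pos.eq_here_or_tgt : ∀ {B : Bat} (p : Pos B 0), p = .here ∨ ∃ q : Pos B 1, q.tgt = p
  | _, .here => .inl rfl
  | .cons _ _, .inr q => by
    rcases q.eq_here_or_tgt with rfl | ⟨r, rfl⟩
    · exact .inr ⟨.inl .here, rfl⟩
    · exact .inr ⟨.inr r, rfl⟩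

theorem Pos.tgt_ne_here {B : Bat} (p : Pos B 1) : p.tgt ≠ .here := by
  cases p <;> simp [Pos.tgt]

theorem Pos.src_ne_tgt : ∀ {B : Bat} {n : ℕ} (p : Pos B (n + 1)), p.src ≠ p.tgt
  | _, n, .inr q => fun h => q.src_ne_tgt (by simpa [Pos.src, Pos.tgt] using h)
  | _, 0, .inl p => by simp [Pos.src, Pos.tgt]
  | _, n + 1, .inl p => fun h => p.src_ne_tgt (by simpa [Pos.src, Pos.tgt] using h)

theorem Pos.tgt_one_inr {B L : Bat} (p : Pos (.cons B L) 1) : ∃ q : Pos L 0, p.tgt = .inr q := by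
  cases p with
  | inl p => exact ⟨_, rfl⟩
  | inr p => exact ⟨_, rfl⟩

theorem Pos.dim_le : ∀ {B : Bat} {n : ℕ}, Pos B n → n ≤ B.dim
  | _, _, .here => Nat.zero_le _
  | _, _, .inl p => (Nat.succ_le_succ p.dim_le).trans (le_max_left _ _)
  | _, _, .inr q => q.dim_le.trans (le_max_right _ _)

theorem Pos.exists_dim : ∀ B : Bat, Nonempty (Pos B B.dim)
  | .nil => ⟨.here⟩
  | .cons B L => by
    obtain ⟨p⟩ := exists_dim B
    obtain ⟨q⟩ := exists_dim L
    rcases le_total (B.dim + 1) L.dim with h | h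
    · rw [show (Bat.cons B L).dim = L.dim from max_eq_right h]
      exact ⟨.inr q⟩
    · rw [show (Bat.cons B L).dim = B.dim + 1 from max_eq_left h]
      exact ⟨.inl p⟩

theorem Bat.dim_le_iff {B : Bat} {n : ℕ} : B.dim ≤ n ↔ ∀ m, Pos B m → m ≤ n :=
  ⟨fun h _ p => p.dim_le.trans h, fun h => (Pos.exists_dim B).elim fun p => h _ p⟩

/-! ### Morphisms between trees are injective and rigid -/

/-- The map on positions induced by maps of the first branch and of the remaining ones. -/
def consMapPos {B B' L L' : Bat} (f : ∀ n, Pos B n → Pos B' n) (g : ∀ n, Pos L n → Pos L' n) :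
    (n : ℕ) → Pos (.cons B L) n → Pos (.cons B' L') n
  | _, .here => .here
  | _, .inl p => .inl (f _ p)
  | _, .inr q => .inr (g _ q)

/-- The morphism between trees induced by morphisms of the first branch and of the remaining
ones. -/
def consMap {B B' L L' : Bat} (f : GlobHom B.glob B'.glob) (g : GlobHom L.glob L'.glob)
    (hg : g.app 0 Pos.here = Pos.here) : GlobHom (Bat.cons B L).glob (Bat.cons B' L').glob where
  app := consMapPos f.app g.app
  app_src {n} x := by
    match n, x with
    | _, .inr q => exact congrArg Pos.inr (g.app_src q)
    | 0, .inl p => rfl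
    | n + 1, .inl p => exact congrArg Pos.inl (f.app_src p)
  app_tgt {n} x := by
    match n, x with
    | _, .inr q => exact congrArg Pos.inr (g.app_tgt q)
    | 0, .inl p => exact congrArg Pos.inr hg
    | n + 1, .inl p => exact congrArg Pos.inl (f.app_tgt p)

/-- The inclusion of the branches other than the first one. -/
def inrHom (B L : Bat) : GlobHom L.glob (Bat.cons B L).glob where
  app _ q := Pos.inr q
  app_src _ := rfl
  app_tgt _ := rfl

/-- Every 0-position other than `here` is a target, and targets of 1-positions lie in the tail. In
higher dimensions, a position whose source is in the tail is in the tail itself. -/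
theorem GlobHom.forall_inr {T C M : Bat} (f : GlobHom T.glob (Bat.cons C M).glob) {q₀ : Pos M 0}
    (h : f.app 0 Pos.here = Pos.inr q₀) : ∀ (n : ℕ) (p : Pos T n), ∃ q, f.app n p = Pos.inr q
  | 0, p => by
    rcases p.eq_here_or_tgt with rfl | ⟨r, rfl⟩
    · exact ⟨_, h⟩
    · obtain ⟨q, hq⟩ := Pos.tgt_one_inr (f.app 1 r)
      exact ⟨q, (f.app_tgt r).trans hq⟩
  | n + 1, p => by
    obtain ⟨q, hq⟩ := GlobHom.forall_inr f h n p.src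
    have hs : Pos.src (f.app (n + 1) p) = Pos.inr q := (f.app_src p).symm.trans hq
    generalize f.app (n + 1) p = x at hs
    match n, x with
    | _, .inr q => exact ⟨_, rfl⟩
    | 0, .inl p => cases hs
    | n + 1, .inl p => cases hs

theorem GlobHom.exists_inr {T C M : Bat} (f : GlobHom T.glob (Bat.cons C M).glob) {q₀ : Pos M 0}
    (h : f.app 0 Pos.here = Pos.inr q₀) :
    ∃ g : GlobHom T.glob M.glob, g.app 0 Pos.here = q₀ ∧ f = g.comp (inrHom C M) := by
  choose g hg using f.forall_inr h
  refine ⟨⟨g, fun {n} x => ?_, fun {n} x => ?_⟩, ?_, ?_⟩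
  · exact Pos.inr.inj (((hg _ _).symm.trans (f.app_src x)).trans (congrArg Pos.src (hg _ x)))
  · exact Pos.inr.inj (((hg _ _).symm.trans (f.app_tgt x)).trans (congrArg Pos.tgt (hg _ x)))
  · exact Pos.inr.inj ((hg _ _).symm.trans h)
  · exact GlobHom.ext (funext fun n => funext fun p => hg n p)

theorem GlobHom.forall_inl {B L C M : Bat} (f : GlobHom (Bat.cons B L).glob (Bat.cons C M).glob)
    (h : f.app 0 Pos.here = Pos.here) :
    ∀ (n : ℕ) (p : Pos B n), ∃ q, f.app (n + 1) (Pos.inl p) = Pos.inl q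
  | 0, p => by
    have hs : Pos.src (f.app 1 (Pos.inl p)) = Pos.here := (f.app_src (Pos.inl p)).symm.trans h
    generalize f.app 1 (Pos.inl p) = x at hs
    cases x with
    | inl p => exact ⟨_, rfl⟩
    | inr q => cases hs
  | n + 1, p => by
    obtain ⟨q, hq⟩ := GlobHom.forall_inl f h n p.src
    have hs : Pos.src (f.app (n + 2) (Pos.inl p)) = Pos.inl q :=
      (f.app_src (Pos.inl p)).symm.trans hq
    generalize f.app (n + 2) (Pos.inl p) = x at hs
    cases x with
    | inl p => exact ⟨_, rfl⟩
    | inr q => cases hs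

/-- Sources keep the first branch inside the first branch. The second object is a target of a
position of that branch, so it goes to the second object, and then the tail goes to the tail. -/
theorem GlobHom.exists_consMap {B L C M : Bat}
    (f : GlobHom (Bat.cons B L).glob (Bat.cons C M).glob) (h : f.app 0 Pos.here = Pos.here) :
    ∃ (g : GlobHom B.glob C.glob) (k : GlobHom L.glob M.glob) (hk : k.app 0 Pos.here = Pos.here),
      f = consMap g k hk := by
  choose g hg using f.forall_inl h
  have h1 : f.app 0 (Pos.inr Pos.here) = Pos.inr Pos.here := by
    refine (f.app_tgt (Pos.inl Pos.here)).trans ?_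
    rw [hg]
    rfl
  obtain ⟨k, hk, hk'⟩ := GlobHom.exists_inr ((inrHom B L).comp f) h1
  refine ⟨⟨g, fun {n} x => ?_, fun {n} x => ?_⟩, k, hk, ?_⟩
  · exact Pos.inl.inj (((hg _ _).symm.trans (f.app_src (Pos.inl x))).trans
      (congrArg Pos.src (hg _ x)))
  · exact Pos.inl.inj (((hg _ _).symm.trans (f.app_tgt (Pos.inl x))).trans
      (congrArg Pos.tgt (hg _ x)))
  · refine GlobHom.ext (funext fun n => funext fun p => ?_)
    cases p with
    | here => exact h
    | inl p => exact hg _ p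
    | inr q => exact congrFun (congrFun (congrArg GlobHom.app hk') _) q

theorem GlobHom.eq_nil {T : Bat} (f : GlobHom T.glob Bat.nil.glob) : T = .nil := by
  cases T with
  | nil => rfl
  | cons B L => exact nomatch (f.app 1 (Pos.inl Pos.here) : Pos Bat.nil 1)

/-- Induction on the codomain: either the base point goes to the base point and the map splits into
branch and tail, or it goes to the tail and the whole map follows. -/
theorem GlobHom.injective : ∀ {C T : Bat} (f : GlobHom T.glob C.glob) (n : ℕ),
    Function.Injective (f.app n)
  | .nil, T, f, n => by
    obtain rfl := f.eq_nil
    intro p q _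
    cases p
    cases q
    rfl
  | .cons C M, T, f, n => by
    rcases h : (f.app 0 Pos.here : Pos (.cons C M) 0) with _ | _ | q₀
    · cases T with
      | nil =>
        intro p q _
        cases p
        cases q
        rfl
      | cons B L =>
        obtain ⟨g, k, hk, rfl⟩ := f.exists_consMap h
        intro p q hpq
        change consMapPos g.app k.app _ p = consMapPos g.app k.app _ q at hpq
        match n, p, q with
        | _, .here, .here => rfl
        | _, .here, .inr _ => cases hpq
        | _, .inr _, .here => cases hpq
        | _, .inl p, .inl q => exact congrArg Pos.inl (g.injective _ (Pos.inl.inj hpq))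
        | _, .inl _, .inr _ => cases hpq
        | _, .inr _, .inl _ => cases hpq
        | _, .inr p, .inr q => exact congrArg Pos.inr (k.injective _ (Pos.inr.inj hpq))
    · obtain ⟨g, -, rfl⟩ := f.exists_inr h
      exact fun p q hpq => g.injective _ (Pos.inr.inj hpq)

theorem GlobHom.app_here_of_surjective {T C : Bat} (f : GlobHom T.glob C.glob)
    (hf : Function.Surjective (f.app 0)) : f.app 0 Pos.here = Pos.here := by
  obtain ⟨p, hp⟩ := hf Pos.here
  rcases Pos.eq_here_or_tgt p with rfl | ⟨r, rfl⟩
  · exact hp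
  · exact absurd ((f.app_tgt r).symm.trans hp) (Pos.tgt_ne_here _)

/-- Surjective morphisms between trees are identities. -/
theorem GlobHom.eq_id_of_surjective : ∀ {C T : Bat} (f : GlobHom T.glob C.glob),
    (∀ n, Function.Surjective (f.app n)) →
      (⟨T, f⟩ : Σ T : Bat, GlobHom T.glob C.glob) = ⟨C, GlobHom.id _⟩
  | .nil, T, f, hf => by
    obtain rfl := f.eq_nil
    congr 1
    refine GlobHom.ext (funext fun n => funext fun p => ?_)
    cases p
    generalize f.app 0 Pos.here = x
    cases x
    rfl
  | .cons C M, .nil, f, hf => by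
    obtain ⟨p, -⟩ := hf 1 (Pos.inl Pos.here)
    exact nomatch (p : Pos Bat.nil 1)
  | .cons C M, .cons B L, f, hf => by
    -- Only the base point can be sent to the base point, since every other 0-position is a target.
    obtain ⟨g, k, hk, rfl⟩ := f.exists_consMap (f.app_here_of_surjective (hf 0))
    have hg' : ∀ n, Function.Surjective (g.app n) := fun n p => by
      obtain ⟨x, hx⟩ := hf (n + 1) (Pos.inl p)
      change consMapPos g.app k.app _ x = _ at hx
      cases x with
      | inl x => exact ⟨x, Pos.inl.inj hx⟩
      | inr x => cases hx
    have hk' : ∀ n, Function.Surjective (k.app n) := fun n p => by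
      obtain ⟨x, hx⟩ := hf n (Pos.inr p)
      change consMapPos g.app k.app _ x = _ at hx
      cases x with
      | here => cases hx
      | inl x => cases hx
      | inr x => exact ⟨x, Pos.inr.inj hx⟩
    have h1 := GlobHom.eq_id_of_surjective g hg'
    have h2 := GlobHom.eq_id_of_surjective k hk'
    obtain rfl : B = C := congrArg Sigma.fst h1
    obtain rfl : L = M := congrArg Sigma.fst h2
    obtain rfl : g = GlobHom.id _ := eq_of_heq (Sigma.mk.inj h1).2
    obtain rfl : k = GlobHom.id _ := eq_of_heq (Sigma.mk.inj h2).2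
    congr 1
    refine GlobHom.ext (funext fun n => funext fun p => ?_)
    cases p <;> rfl

theorem GlobHom.exists_fac {T T' : Bat} {X : GlobSet} (f : GlobHom T.glob X)
    (f' : GlobHom T'.glob X) (hf' : ∀ n, Function.Injective (f'.app n))
    (h : ∀ n p, f.app n p ∈ Set.range (f'.app n)) :
    ∃ g : GlobHom T.glob T'.glob, g.comp f' = f := by
  choose g hg using h
  refine ⟨⟨g, fun {n} x => hf' _ ?_, fun {n} x => hf' _ ?_⟩,
    GlobHom.ext (funext fun n => funext fun p => hg n p)⟩
  · rw [f'.app_src, hg, hg, f.app_src]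
  · rw [f'.app_tgt, hg, hg, f.app_tgt]

/-- A morphism between trees is determined by its image, and so is its domain. -/
theorem GlobHom.eq_of_range_eq {T T' C : Bat} (f : GlobHom T.glob C.glob)
    (f' : GlobHom T'.glob C.glob) (h : ∀ n, Set.range (f.app n) = Set.range (f'.app n)) :
    (⟨T, f⟩ : Σ T : Bat, GlobHom T.glob C.glob) = ⟨T', f'⟩ := by
  obtain ⟨g, rfl⟩ := f.exists_fac f' f'.injective (fun n p => h n ▸ Set.mem_range_self p)
  have hg : ∀ n, Function.Surjective (g.app n) := fun n p => by
    obtain ⟨q, hq⟩ := (h n).symm ▸ Set.mem_range_self p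
    exact ⟨q, f'.injective n hq⟩
  have := g.eq_id_of_surjective hg
  obtain rfl : T = T' := congrArg Sigma.fst this
  obtain rfl : g = GlobHom.id _ := eq_of_heq (Sigma.mk.inj this).2
  rfl

/-! ### Boundaries of trees as sets of positions -/

/-- The source (`false`) or target (`true`) of a position. -/
def Pos.face {B : Bat} : Bool → {n : ℕ} → Pos B (n + 1) → Pos B n
  | false, _, p => p.src
  | true, _, p => p.tgt

/-- The source or target boundary positions. -/
def bdry (e : Bool) (B : Bat) (n : ℕ) : Set (Pos B n) := {p | ∀ q : Pos B (n + 1), q.face (!e) ≠ p}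

theorem srcBoundary_eq (B : Bat) (n : ℕ) : srcBoundary B n = bdry false B n := by
  ext p
  simp [srcBoundary, bdry, Pos.face]

theorem tgtBoundary_eq (B : Bat) (n : ℕ) : tgtBoundary B n = bdry true B n := by
  ext p
  simp [tgtBoundary, bdry, Pos.face]

theorem Pos.face_inr {B L : Bat} (e : Bool) {n : ℕ} (q : Pos L (n + 1)) :
    (Pos.inr q : Pos (.cons B L) (n + 1)).face e = .inr (q.face e) := by
  cases e <;> rfl

theorem Pos.face_inl {B L : Bat} (e : Bool) {n : ℕ} (p : Pos B (n + 1)) :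
    (Pos.inl p : Pos (.cons B L) (n + 2)).face e = .inl (p.face e) := by
  cases e <;> rfl

theorem Pos.face_face {B : Bat} (e d : Bool) {n : ℕ} (p : Pos B (n + 2)) :
    (p.face d).face e = (p.face (!d)).face e := by
  cases e <;> cases d <;> simp [Pos.face, Pos.src_src, Pos.tgt_src]

theorem Pos.face_ne {B : Bat} (e : Bool) {n : ℕ} (p : Pos B (n + 1)) : p.face e ≠ p.face (!e) := by
  cases e
  · exact p.src_ne_tgt
  · exact p.src_ne_tgt.symm

theorem GlobHom.app_face {B C : Bat} (f : GlobHom B.glob C.glob) (e : Bool) {n : ℕ}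
    (p : Pos B (n + 1)) : f.app n (p.face e) = Pos.face e (f.app (n + 1) p) := by
  cases e
  · exact f.app_src p
  · exact f.app_tgt p

theorem inl_mem_bdry {B L : Bat} {e : Bool} {n : ℕ} {p : Pos B n} :
    (Pos.inl p : Pos (.cons B L) (n + 1)) ∈ bdry e _ _ ↔ p ∈ bdry e B n := by
  constructor
  · intro h q hq
    exact h (.inl q) (by rw [Pos.face_inl, hq])
  · intro h q hq
    cases q with
    | inl q =>
      rw [Pos.face_inl] at hq
      exact h q (Pos.inl.inj hq)
    | inr q =>
      rw [Pos.face_inr] at hq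
      cases hq

theorem inr_succ_mem_bdry {B L : Bat} {e : Bool} {n : ℕ} {q : Pos L (n + 1)} :
    (Pos.inr q : Pos (.cons B L) (n + 1)) ∈ bdry e _ _ ↔ q ∈ bdry e L (n + 1) := by
  constructor
  · intro h r hr
    exact h (.inr r) (by rw [Pos.face_inr, hr])
  · intro h r hr
    cases r with
    | inl r =>
      rw [Pos.face_inl] at hr
      cases hr
    | inr r =>
      rw [Pos.face_inr] at hr
      exact h r (Pos.inr.inj hr)

theorem inr_zero_mem_bdry {B L : Bat} {q : Pos L 0} :
    (Pos.inr q : Pos (.cons B L) 0) ∈ bdry true _ _ ↔ q ∈ bdry true L 0 := by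
  constructor
  · intro h r hr
    exact h (.inr r) (congrArg Pos.inr hr)
  · intro h r hr
    cases r with
    | inl r => cases hr
    | inr r => exact h r (Pos.inr.inj hr)

theorem inr_zero_notMem_bdry {B L : Bat} {q : Pos L 0} :
    (Pos.inr q : Pos (.cons B L) 0) ∉ bdry false _ _ := by
  intro h
  rcases q.eq_here_or_tgt with rfl | ⟨r, rfl⟩
  · exact h (.inl .here) rfl
  · exact h (.inr r) rfl

theorem here_mem_bdry {B : Bat} : (Pos.here : Pos B 0) ∈ bdry false _ _ := fun q => q.tgt_ne_here

theorem here_notMem_bdry {B L : Bat} : (Pos.here : Pos (.cons B L) 0) ∉ bdry true _ _ :=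
  fun h => h (.inl .here) rfl

theorem here_mem_bdry_nil : (Pos.here : Pos .nil 0) ∈ bdry true _ _ := nofun

theorem exists_mem_bdry_zero : ∀ (e : Bool) (B : Bat), ∃ p, p ∈ bdry e B 0
  | false, _ => ⟨_, here_mem_bdry⟩
  | true, .nil => ⟨_, here_mem_bdry_nil⟩
  | true, .cons _ L => by
    obtain ⟨p, hp⟩ := exists_mem_bdry_zero true L
    exact ⟨_, inr_zero_mem_bdry.2 hp⟩

/-- Every position is parallel to one in the boundary. -/
theorem exists_parallel_mem_bdry (e : Bool) : ∀ {B : Bat} {n : ℕ} (p : Pos B (n + 1)),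
    ∃ q ∈ bdry e B (n + 1), ∀ d, q.face d = p.face d
  | _, n, .inr p => by
    obtain ⟨q, hq, h⟩ := exists_parallel_mem_bdry e p
    exact ⟨.inr q, inr_succ_mem_bdry.2 hq, fun d => by rw [Pos.face_inr, Pos.face_inr, h]⟩
  -- All 1-positions of the first branch are parallel, so the first or the last object of `B` can be
  -- used.
  | .cons B _, 0, .inl p => by
    obtain ⟨q, hq⟩ := exists_mem_bdry_zero e B
    exact ⟨.inl q, inl_mem_bdry.2 hq, fun d => by cases d <;> rfl⟩
  | _, n + 1, .inl p => by
    obtain ⟨q, hq, h⟩ := exists_parallel_mem_bdry e p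
    exact ⟨.inl q, inl_mem_bdry.2 hq, fun d => by rw [Pos.face_inl, Pos.face_inl, h]⟩

/-- Describes the `k`-source inside `B` without mentioning the tree `B.bd k`; this is what turns
boundaries into operations on sets. -/
theorem exists_srcIncl_iff : ∀ (k : ℕ) (B : Bat) {n : ℕ} (p : Pos B n),
    (∃ z, srcIncl k B z = p) ↔ n ≤ k ∧ (n = k → p ∈ bdry false B n)
  | 0, .nil, _, .here => by simpa [here_mem_bdry] using ⟨_, rfl⟩
  | _ + 1, .nil, _, .here => by simpa using ⟨_, rfl⟩
  | 0, .cons _ _, _, .here => by simpa [here_mem_bdry] using ⟨Pos.here, rfl⟩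
  | 0, .cons _ _, _, .inl p => by simpa using fun z => nomatch z
  | 0, .cons _ _, 0, .inr q => by
    simpa [inr_zero_notMem_bdry] using fun z => by cases z; nofun
  | 0, .cons _ _, _ + 1, .inr q => by simpa using fun z => nomatch z
  | k + 1, .cons _ _, _, .here => by simpa using ⟨Pos.here, rfl⟩
  | k + 1, .cons B L, n + 1, .inl p => by
    rw [Nat.succ_le_succ_iff, Nat.succ_inj, inl_mem_bdry, ← exists_srcIncl_iff k B p]
    constructor
    · rintro ⟨_ | z | z, hz⟩
      · exact ⟨z, Pos.inl.inj hz⟩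
      · cases hz
    · rintro ⟨z, rfl⟩
      exact ⟨.inl z, rfl⟩
  | k + 1, .cons B L, n, .inr q => by
    have : (n = k + 1 → (Pos.inr q : Pos (.cons B L) n) ∈ bdry false _ _) ↔
        (n = k + 1 → q ∈ bdry false _ _) := by
      refine forall_congr' ?_
      rintro rfl
      exact inr_succ_mem_bdry
    rw [this, ← exists_srcIncl_iff (k + 1) L q]
    constructor
    · rintro ⟨_ | z | z, hz⟩
      · cases hz
      · cases hz
      · exact ⟨z, Pos.inr.inj hz⟩
    · rintro ⟨z, rfl⟩
      exact ⟨.inr z, rfl⟩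

theorem exists_tgtIncl_iff : ∀ (k : ℕ) (B : Bat) {n : ℕ} (p : Pos B n),
    (∃ z, tgtIncl k B z = p) ↔ n ≤ k ∧ (n = k → p ∈ bdry true B n)
  | 0, .nil, _, .here => by simpa [here_mem_bdry_nil] using ⟨_, rfl⟩
  | _ + 1, .nil, _, .here => by simpa using ⟨_, rfl⟩
  | 0, .cons _ _, _, .here => by
    simpa [here_notMem_bdry] using fun z => by cases z; nofun
  | 0, .cons _ _, _, .inl p => by simpa using fun z => nomatch z
  | 0, .cons _ L, 0, .inr q => by
    have := exists_tgtIncl_iff 0 L q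
    simp only [le_refl, true_and, forall_const] at this ⊢
    rw [inr_zero_mem_bdry, ← this]
    constructor
    · rintro ⟨z, hz⟩
      cases z
      exact ⟨_, Pos.inr.inj hz⟩
    · rintro ⟨z, rfl⟩
      cases L <;> cases z <;> exact ⟨.here, rfl⟩
  | 0, .cons _ _, _ + 1, .inr q => by simpa using fun z => nomatch z
  | k + 1, .cons _ _, _, .here => by simpa using ⟨Pos.here, rfl⟩
  | k + 1, .cons B L, n + 1, .inl p => by
    rw [Nat.succ_le_succ_iff, Nat.succ_inj, inl_mem_bdry, ← exists_tgtIncl_iff k B p]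
    constructor
    · rintro ⟨_ | z | z, hz⟩
      · exact ⟨z, Pos.inl.inj hz⟩
      · cases hz
    · rintro ⟨z, rfl⟩
      exact ⟨.inl z, rfl⟩
  | k + 1, .cons B L, n, .inr q => by
    have : (n = k + 1 → (Pos.inr q : Pos (.cons B L) n) ∈ bdry true _ _) ↔
        (n = k + 1 → q ∈ bdry true _ _) := by
      refine forall_congr' ?_
      rintro rfl
      exact inr_succ_mem_bdry
    rw [this, ← exists_tgtIncl_iff (k + 1) L q]
    constructor
    · rintro ⟨_ | z | z, hz⟩
      · cases hz
      · cases hz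
      · exact ⟨z, Pos.inr.inj hz⟩
    · rintro ⟨z, rfl⟩
      exact ⟨.inr z, rfl⟩

/-! ### Cells of the free strict `ω`-category on a tree, as sets of positions -/

/-- A set of positions in each dimension. -/
abbrev PosSet (B : Bat) : Type := ∀ n : ℕ, Set (Pos B n)

namespace PosSet

variable {B : Bat}

/-- The `k`-dimensional source (`false`) or target (`true`) of a set of positions. -/
def bd (e : Bool) (k : ℕ) (U : PosSet B) : PosSet B :=
  fun n => {p | p ∈ U n ∧ n ≤ k ∧ (n = k → ∀ q ∈ U (n + 1), q.face (!e) ≠ p)}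

/-- The sets of positions that are images of trees. -/
def IsTree (U : PosSet B) : Prop :=
  ∃ (T : Bat) (f : GlobHom T.glob B.glob), ∀ n, U n = Set.range (f.app n)

theorem IsTree.face_mem {U : PosSet B} (hU : U.IsTree) (e : Bool) {n : ℕ} {p : Pos B (n + 1)}
    (hp : p ∈ U (n + 1)) : p.face e ∈ U n := by
  obtain ⟨T, f, hf⟩ := hU
  rw [hf] at hp ⊢
  obtain ⟨q, rfl⟩ := hp
  exact ⟨Pos.face e q, f.app_face e q⟩

theorem bd_of_le {U : PosSet B} {n k : ℕ} (h : ∀ m p, p ∈ U m → m ≤ n) (hk : n ≤ k) (e : Bool) :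
    U.bd e k = U := by
  ext m p
  refine ⟨fun hp => hp.1, fun hp => ⟨hp, (h _ _ hp).trans hk, ?_⟩⟩
  rintro rfl q hq
  exact absurd (h _ _ hq) (by omega)

/-- A position witnessing that `p` is not in the `j`-boundary may be lost in the `k`-boundary when
`k = j + 1`. A parallel position that survives there replaces it. -/
theorem IsTree.bd_bd {U : PosSet B} (hU : U.IsTree) (e : Bool) {j k : ℕ} (hjk : j < k) :
    (U.bd e k).bd e j = U.bd e j := by
  ext n p
  constructor
  · rintro ⟨⟨hp, -, -⟩, hn, h⟩
    refine ⟨hp, hn, ?_⟩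
    rintro rfl q hq hqp
    obtain ⟨T, f, hf⟩ := hU
    have hq' := hq
    rw [hf] at hq'
    obtain ⟨q, rfl⟩ := hq'
    obtain ⟨r, hr, hrq⟩ := exists_parallel_mem_bdry e q
    refine h rfl (f.app _ r) ⟨hf _ ▸ Set.mem_range_self r, hjk, ?_⟩ ?_
    · rintro - s hs hsr
      rw [hf] at hs
      obtain ⟨s, rfl⟩ := hs
      exact hr s (f.injective _ ((f.app_face _ s).trans hsr))
    · exact ((f.app_face _ r).symm.trans (congrArg (f.app _) (hrq _))).trans
        ((f.app_face _ q).trans hqp)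
  · rintro ⟨hp, hn, h⟩
    exact ⟨⟨hp, by omega, by omega⟩, hn, fun hj q hq => h hj q hq.1⟩

/-- With `e = false` this gives sources of a composite of `U` and `V`; with `e = true` and the
factors exchanged it gives targets. If a face of `V` excluded a position of `U`, that position would
lie in the intersection, hence in `V.bd e k`, where no position of `V` can exclude it. -/
theorem bd_sup_of_le {U V : PosSet B} (hU : U.IsTree) (hV : V.IsTree) (hUV : (U ⊔ V).IsTree)
    {e : Bool} {k : ℕ} (h : U.bd (!e) k = V.bd e k)
    (hi : ∀ n p, p ∈ U n → p ∈ V n → p ∈ U.bd (!e) k n) {j : ℕ} (hj : j ≤ k) :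
    (U ⊔ V).bd e j = U.bd e j := by
  have key : (U ⊔ V).bd e k = U.bd e k := by
    ext n p
    constructor
    · rintro ⟨hp, hn, hq⟩
      refine ⟨?_, hn, fun hk q hqU => hq hk q (Or.inl hqU)⟩
      rcases hp with hp | hp
      · exact hp
      · have : p ∈ V.bd e k n := ⟨hp, hn, fun hk q hqV => hq hk q (Or.inr hqV)⟩
        rw [← h] at this
        exact this.1
    · rintro ⟨hp, hn, hq⟩
      refine ⟨Or.inl hp, hn, ?_⟩
      rintro hk q (hqU | hqV) hqp
      · exact hq hk q hqU hqp
      · have := hi n p hp (hqp ▸ hV.face_mem _ hqV)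
        rw [h] at this
        exact this.2.2 hk q hqV hqp
  rcases hj.eq_or_lt with rfl | hj
  · exact key
  · rw [← hUV.bd_bd e hj, key, hU.bd_bd e hj]

/-- No position of dimension `j > k` is shared, so faces taken in one set cannot exclude positions
of the other. -/
theorem bd_sup_of_lt {U V : PosSet B} (hU : U.IsTree) (hV : V.IsTree) {k : ℕ}
    (hi : ∀ n p, p ∈ U n → p ∈ V n → n ≤ k) (e : Bool) {j : ℕ} (hj : k < j) :
    (U ⊔ V).bd e j = U.bd e j ⊔ V.bd e j := by
  ext n p
  constructor
  · rintro ⟨hp | hp, hn, hq⟩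
    · exact Or.inl ⟨hp, hn, fun hk q hqU => hq hk q (Or.inl hqU)⟩
    · exact Or.inr ⟨hp, hn, fun hk q hqV => hq hk q (Or.inr hqV)⟩
  · rintro (⟨hp, hn, hq⟩ | ⟨hp, hn, hq⟩)
    · refine ⟨Or.inl hp, hn, ?_⟩
      rintro hk q (hqU | hqV) hqp
      · exact hq hk q hqU hqp
      · have := hi n p hp (hqp ▸ hV.face_mem _ hqV)
        omega
    · refine ⟨Or.inr hp, hn, ?_⟩
      rintro hk q (hqU | hqV) hqp
      · have := hi n p (hqp ▸ hU.face_mem _ hqU) hp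
        omega
      · exact hq hk q hqV hqp

end PosSet

/-- The inclusion of the `k`-boundary of a tree as its source (`false`) or target (`true`). -/
def bdInc (e : Bool) (k : ℕ) (B : Bat) : GlobHom (B.bd k).glob B.glob :=
  match e with
  | false => B.sInc k
  | true => B.tInc k

theorem mem_range_bdInc {e : Bool} {k : ℕ} {B : Bat} {n : ℕ} {p : Pos B n} :
    p ∈ Set.range ((bdInc e k B).app n) ↔ n ≤ k ∧ (n = k → p ∈ bdry e B n) := by
  cases e
  · exact exists_srcIncl_iff k B p
  · exact exists_tgtIncl_iff k B p

namespace StrictCell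

variable {B C : Bat} {n : ℕ}

/-- The `k`-dimensional source (`false`) or target (`true`) of a cell. -/
def bdAt {X : GlobSet} (e : Bool) (k : ℕ) (x : StrictCell X n) : StrictCell X k where
  tree := x.tree.bd k
  dim_le := Bat.dim_bd_le k x.tree
  map := (bdInc e k x.tree).comp x.map

/-- The set of positions that occur in a cell. -/
def supp (x : StrictCell C.glob n) : PosSet C := fun m => Set.range (x.map.app m)

theorem supp_isTree (x : StrictCell C.glob n) : x.supp.IsTree := ⟨x.tree, x.map, fun _ => rfl⟩

/-- Rigidity of trees: the image determines both the shape and the labelling. -/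
theorem supp_injective : Function.Injective (supp : StrictCell C.glob n → PosSet C) := by
  rintro ⟨T, hT, f⟩ ⟨T', hT', f'⟩ h
  have := f.eq_of_range_eq f' (congrFun h)
  cases this
  rfl

theorem le_of_mem_supp (x : StrictCell C.glob n) (m : ℕ) (p : Pos C m) (hp : p ∈ x.supp m) :
    m ≤ n := by
  obtain ⟨q, -⟩ := hp
  exact (Pos.dim_le q).trans x.dim_le

theorem exists_supp_eq {U : PosSet C} (hU : U.IsTree) (h : ∀ m p, p ∈ U m → m ≤ n) :
    ∃ x : StrictCell C.glob n, x.supp = U := by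
  obtain ⟨T, f, hf⟩ := hU
  refine ⟨⟨T, Bat.dim_le_iff.2 fun m p => h m (f.app m p) (hf m ▸ Set.mem_range_self p), f⟩, ?_⟩
  exact funext fun m => (hf m).symm

/-- As `x.map` is injective, the boundary positions of the tree correspond to the elements of the
image that are not an opposite face of another element of the image. -/
theorem supp_bdAt (e : Bool) (k : ℕ) (x : StrictCell C.glob n) :
    (x.bdAt e k).supp = x.supp.bd e k := by
  ext m p
  constructor
  · rintro ⟨z, rfl⟩
    obtain ⟨h1, h2⟩ := mem_range_bdInc.1 (Set.mem_range_self (f := (bdInc e k x.tree).app m) z)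
    refine ⟨⟨_, rfl⟩, h1, ?_⟩
    rintro hk _ ⟨q, rfl⟩ hq
    exact h2 hk q (x.map.injective _ ((x.map.app_face _ q).trans hq))
  · rintro ⟨⟨q, rfl⟩, hm, h⟩
    have : q ∈ Set.range ((bdInc e k x.tree).app m) := by
      refine mem_range_bdInc.2 ⟨hm, fun hk r hr => h hk _ ⟨r, rfl⟩ ?_⟩
      rw [← hr]
      exact (x.map.app_face _ r).symm
    obtain ⟨z, rfl⟩ := this
    exact ⟨z, rfl⟩

end StrictCell

/-! ### Gluing of trees is a pushout -/

/-- Transport of positions along an equality of trees. -/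
def posCast {B C : Bat} (h : B = C) {n : ℕ} (p : Pos B n) : Pos C n := h ▸ p

theorem posCast_here {B C : Bat} (h : B = C) : posCast h (.here : Pos B 0) = .here := by
  subst h; rfl

theorem posCast_inl {B C L M : Bat} (h : Bat.cons B L = Bat.cons C M) {n : ℕ} (p : Pos B n) :
    posCast h (.inl p) = .inl (posCast (Bat.cons.inj h).1 p) := by
  cases h; rfl

theorem posCast_inr {B C L M : Bat} (h : Bat.cons B L = Bat.cons C M) {n : ℕ} (p : Pos L n) :
    posCast h (.inr p) = .inr (posCast (Bat.cons.inj h).2 p) := by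
  cases h; rfl

theorem glueLeft_src : ∀ (k : ℕ) (B C : Bat) {n : ℕ} (p : Pos B (n + 1)),
    glueLeft k B C p.src = (glueLeft k B C p).src
  | 0, .cons _ _, _, 0, .inl _ => rfl
  | 0, .cons _ _, _, _ + 1, .inl _ => rfl
  | 0, .cons _ L, C, _, .inr q => congrArg Pos.inr (glueLeft_src 0 L C q)
  | _ + 1, .cons _ _, .nil, _, _ => rfl
  | _ + 1, .cons _ _, .cons _ _, 0, .inl _ => rfl
  | k + 1, .cons B _, .cons C _, _ + 1, .inl p => congrArg Pos.inl (glueLeft_src k B C p)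
  | k + 1, .cons _ L, .cons _ M, _, .inr q => congrArg Pos.inr (glueLeft_src (k + 1) L M q)

theorem glueLeft_here (k : ℕ) (B C : Bat) : glueLeft k B C .here = .here := by
  cases k <;> cases B <;> cases C <;> rfl

theorem glueRight_here (k : ℕ) (B C : Bat) : glueRight (k + 1) B C .here = .here := by
  cases B <;> cases C <;> rfl

theorem glueLeft_tgt : ∀ (k : ℕ) (B C : Bat) {n : ℕ} (p : Pos B (n + 1)),
    glueLeft k B C p.tgt = (glueLeft k B C p).tgt
  | 0, .cons _ L, C, 0, .inl _ => congrArg Pos.inr (glueLeft_here 0 L C)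
  | 0, .cons _ _, _, _ + 1, .inl _ => rfl
  | 0, .cons _ L, C, _, .inr q => congrArg Pos.inr (glueLeft_tgt 0 L C q)
  | _ + 1, .cons _ _, .nil, _, _ => rfl
  | k + 1, .cons _ L, .cons _ M, 0, .inl _ => congrArg Pos.inr (glueLeft_here (k + 1) L M)
  | k + 1, .cons B _, .cons C _, _ + 1, .inl p => congrArg Pos.inl (glueLeft_tgt k B C p)
  | k + 1, .cons _ L, .cons _ M, _, .inr q => congrArg Pos.inr (glueLeft_tgt (k + 1) L M q)

theorem glueRight_src : ∀ (k : ℕ) (B C : Bat) {n : ℕ} (p : Pos C (n + 1)),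
    glueRight k B C p.src = (glueRight k B C p).src
  | 0, .nil, _, _, _ => rfl
  | 0, .cons _ L, C, _, q => congrArg Pos.inr (glueRight_src 0 L C q)
  | _ + 1, .nil, _, _, _ => rfl
  | _ + 1, .cons _ _, .cons _ _, 0, .inl _ => rfl
  | k + 1, .cons B _, .cons C _, _ + 1, .inl p => congrArg Pos.inl (glueRight_src k B C p)
  | k + 1, .cons _ L, .cons _ M, _, .inr q => congrArg Pos.inr (glueRight_src (k + 1) L M q)

theorem glueRight_tgt : ∀ (k : ℕ) (B C : Bat) {n : ℕ} (p : Pos C (n + 1)),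
    glueRight k B C p.tgt = (glueRight k B C p).tgt
  | 0, .nil, _, _, _ => rfl
  | 0, .cons _ L, C, _, q => congrArg Pos.inr (glueRight_tgt 0 L C q)
  | _ + 1, .nil, _, _, _ => rfl
  | k + 1, .cons _ L, .cons _ M, 0, .inl _ => congrArg Pos.inr (glueRight_here k L M)
  | k + 1, .cons B _, .cons C _, _ + 1, .inl p => congrArg Pos.inl (glueRight_tgt k B C p)
  | k + 1, .cons _ L, .cons _ M, _, .inr q => congrArg Pos.inr (glueRight_tgt (k + 1) L M q)

theorem glue_cover : ∀ (k : ℕ) (B C : Bat) {n : ℕ} (p : Pos (Bat.glue k B C) n),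
    (∃ q, glueLeft k B C q = p) ∨ ∃ q, glueRight k B C q = p
  | 0, .nil, _, _, p => .inr ⟨p, rfl⟩
  | 0, .cons _ _, _, _, .here => .inl ⟨.here, rfl⟩
  | 0, .cons _ _, _, _, .inl p => .inl ⟨.inl p, rfl⟩
  | 0, .cons _ L, C, _, .inr p =>
    (glue_cover 0 L C p).imp (fun ⟨q, h⟩ => ⟨.inr q, congrArg Pos.inr h⟩)
      (fun ⟨q, h⟩ => ⟨q, congrArg Pos.inr h⟩)
  | _ + 1, .nil, _, _, p => .inr ⟨p, rfl⟩
  | _ + 1, .cons _ _, .nil, _, p => .inl ⟨p, rfl⟩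
  | _ + 1, .cons _ _, .cons _ _, _, .here => .inl ⟨.here, rfl⟩
  | k + 1, .cons B _, .cons C _, _, .inl p =>
    (glue_cover k B C p).imp (fun ⟨q, h⟩ => ⟨.inl q, congrArg Pos.inl h⟩)
      (fun ⟨q, h⟩ => ⟨.inl q, congrArg Pos.inl h⟩)
  | k + 1, .cons _ L, .cons _ M, _, .inr p =>
    (glue_cover (k + 1) L M p).imp (fun ⟨q, h⟩ => ⟨.inr q, congrArg Pos.inr h⟩)
      (fun ⟨q, h⟩ => ⟨.inr q, congrArg Pos.inr h⟩)

theorem Bat.bd_zero (B : Bat) : B.bd 0 = .nil := by cases B <;> rfl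

theorem glueLeft_tgtIncl_zero : ∀ B C : Bat,
    glueLeft 0 B C (tgtIncl 0 B .here) = glueRight 0 B C .here
  | .nil, _ => rfl
  | .cons _ L, C => congrArg Pos.inr (glueLeft_tgtIncl_zero L C)

theorem Pos.of_bd_zero {B : Bat} {P : ∀ n, Pos (B.bd 0) n → Prop} (h : P 0 .here) {n : ℕ}
    (z : Pos (B.bd 0) n) : P n z := by
  cases B <;> cases z <;> exact h

/-- One of three facts that make the glued tree a pushout: the square commutes, the two inclusions
are jointly surjective (`glue_cover`), and they overlap only in the common boundary
(`exists_of_glueLeft_eq_glueRight`). -/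
theorem glueLeft_tgtIncl : ∀ (k : ℕ) (B C : Bat) (h : B.bd k = C.bd k) {n : ℕ}
    (z : Pos (B.bd k) n),
    glueLeft k B C (tgtIncl k B z) = glueRight k B C (srcIncl k C (posCast h z))
  | 0, B, C, h, n, z => by
    refine Pos.of_bd_zero
      (P := fun n z => glueLeft 0 B C (tgtIncl 0 B z) = glueRight 0 B C (srcIncl 0 C (posCast h z)))
      ?_ z
    rw [posCast_here, srcIncl_here, glueLeft_tgtIncl_zero]
  | _ + 1, .nil, .nil, _, _, .here => rfl
  | _ + 1, .nil, .cons _ _, h, _, _ => nomatch h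
  | _ + 1, .cons _ _, .nil, h, _, _ => nomatch h
  | _ + 1, .cons _ _, .cons _ _, h, _, .here => by rw [posCast_here]; rfl
  | k + 1, .cons B L, .cons C M, h, _, .inl z =>
    (congrArg Pos.inl (glueLeft_tgtIncl k B C _ z)).trans
      (congrArg (fun w => glueRight (k + 1) (.cons B L) (.cons C M) (srcIncl (k + 1) (.cons C M) w))
        (posCast_inl h z)).symm
  | k + 1, .cons B L, .cons C M, h, _, .inr z =>
    (congrArg Pos.inr (glueLeft_tgtIncl (k + 1) L M _ z)).trans
      (congrArg (fun w => glueRight (k + 1) (.cons B L) (.cons C M) (srcIncl (k + 1) (.cons C M) w))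
        (posCast_inr h z)).symm

/-- Along dimension 0 the overlap is one object, the last of `B` and the first of `C`. -/
theorem exists_of_glueLeft_eq_glueRight_zero : ∀ (B C : Bat) {n : ℕ} (p : Pos B n) (q : Pos C n),
    glueLeft 0 B C p = glueRight 0 B C q →
      ∃ h : 0 = n, tgtIncl 0 B .here = h ▸ p ∧ Pos.here = h ▸ q
  | .nil, _, _, .here, q, h => ⟨rfl, rfl, h⟩
  | .cons _ L, C, _, .inr p, q, h => by
    obtain ⟨rfl, h1, h2⟩ := exists_of_glueLeft_eq_glueRight_zero L C p q (Pos.inr.inj h)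
    exact ⟨rfl, congrArg Pos.inr h1, h2⟩

theorem exists_of_glueLeft_eq_glueRight : ∀ (k : ℕ) (B C : Bat) (h : B.bd k = C.bd k) {n : ℕ}
    (p : Pos B n) (q : Pos C n), glueLeft k B C p = glueRight k B C q →
      ∃ z, tgtIncl k B z = p ∧ srcIncl k C (posCast h z) = q
  | 0, B, C, h, n, p, q, hpq => by
    obtain ⟨rfl, h1, h2⟩ := exists_of_glueLeft_eq_glueRight_zero B C p q hpq
    exact ⟨.here, h1, by rw [posCast_here, srcIncl_here]; exact h2⟩
  | _ + 1, .nil, .nil, _, _, .here, .here, _ => ⟨.here, rfl, rfl⟩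
  | _ + 1, .nil, .cons _ _, h, _, _, _, _ => nomatch h
  | _ + 1, .cons _ _, .nil, h, _, _, _, _ => nomatch h
  | _ + 1, .cons _ _, .cons _ _, h, _, .here, .here, _ =>
    ⟨.here, rfl, by rw [posCast_here]; rfl⟩
  | k + 1, .cons B _, .cons C M, h, _, .inl p, .inl q, hpq => by
    obtain ⟨z, h1, h2⟩ := exists_of_glueLeft_eq_glueRight k B C (Bat.cons.inj h).1 p q
      (Pos.inl.inj hpq)
    exact ⟨.inl z, congrArg Pos.inl h1,
      (congrArg (fun w => srcIncl (k + 1) (.cons C M) w) (posCast_inl h z)).trans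
        (congrArg Pos.inl h2)⟩
  | k + 1, .cons _ L, .cons C M, h, _, .inr p, .inr q, hpq => by
    obtain ⟨z, h1, h2⟩ := exists_of_glueLeft_eq_glueRight (k + 1) L M (Bat.cons.inj h).2 p q
      (Pos.inr.inj hpq)
    exact ⟨.inr z, congrArg Pos.inr h1,
      (congrArg (fun w => srcIncl (k + 1) (.cons C M) w) (posCast_inr h z)).trans
        (congrArg Pos.inr h2)⟩

/-- The inclusion of the first tree into the glued tree. -/
def glueLeftHom (k : ℕ) (B C : Bat) : GlobHom B.glob (Bat.glue k B C).glob where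
  app _ := glueLeft k B C
  app_src := glueLeft_src k B C
  app_tgt := glueLeft_tgt k B C

/-- The inclusion of the second tree into the glued tree. -/
def glueRightHom (k : ℕ) (B C : Bat) : GlobHom C.glob (Bat.glue k B C).glob where
  app _ := glueRight k B C
  app_src := glueRight_src k B C
  app_tgt := glueRight_tgt k B C

/-! ### Supports and boundaries of composites -/

namespace StrictCell

variable {C : Bat} {n k : ℕ} {x y z : StrictCell C.glob n}

theorem supp_of_isComposite (h : IsComposite k x y z) : z.supp = x.supp ⊔ y.supp := by
  obtain ⟨-, hd, f, hl, hr, rfl⟩ := h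
  ext m p
  constructor
  · rintro ⟨q, rfl⟩
    rcases glue_cover k x.tree y.tree q with ⟨q, rfl⟩ | ⟨q, rfl⟩
    · exact Or.inl ⟨q, (hl m q).symm⟩
    · exact Or.inr ⟨q, (hr m q).symm⟩
  · rintro (⟨q, rfl⟩ | ⟨q, rfl⟩)
    · exact ⟨_, hl m q⟩
    · exact ⟨_, hr m q⟩

theorem bd_eq_iff : x.supp.bd true k = y.supp.bd false k ↔ x.tgtAt k = y.srcAt k := by
  rw [← supp_bdAt, ← supp_bdAt]
  exact supp_injective.eq_iff

/-- The labelling of the composite is itself a map of trees, hence injective, so positions of `x`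
and `y` that meet in `C` already meet in the glued tree. -/
theorem mem_bd_of_isComposite (h : IsComposite k x y z) {m : ℕ} {p : Pos C m} (hx : p ∈ x.supp m)
    (hy : p ∈ y.supp m) : p ∈ x.supp.bd true k m := by
  obtain ⟨hb, hd, f, hl, hr, rfl⟩ := h
  obtain ⟨q, rfl⟩ := hx
  obtain ⟨r, hr'⟩ := hy
  have : glueLeft k x.tree y.tree q = glueRight k x.tree y.tree r :=
    f.injective m (((hl m q).trans hr'.symm).trans (hr m r).symm)
  obtain ⟨w, hw, -⟩ := exists_of_glueLeft_eq_glueRight k _ _ (congrArg tree hb) q r this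
  rw [← supp_bdAt]
  exact ⟨w, congrArg (x.map.app m) hw⟩

theorem map_app_eq {X : GlobSet} {a b : StrictCell X n} (h : a = b) {m : ℕ} (p : Pos a.tree m) :
    a.map.app m p = b.map.app m (posCast (congrArg tree h) p) := by
  subst h
  rfl

theorem exists_isComposite (h : x.supp.bd true k = y.supp.bd false k) :
    ∃ z, IsComposite k x y z := by
  have hb := bd_eq_iff.1 h
  have ht : x.tree.bd k = y.tree.bd k := congrArg tree hb
  have hov : ∀ m (p : Pos x.tree m) (q : Pos y.tree m),
      glueLeft k x.tree y.tree p = glueRight k x.tree y.tree q →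
        x.map.app m p = y.map.app m q := by
    intro m p q hpq
    obtain ⟨w, rfl, rfl⟩ := exists_of_glueLeft_eq_glueRight k _ _ ht p q hpq
    exact map_app_eq hb w
  -- Imposing the constraints from both sides at once makes the chosen value independent of the side
  -- from which `p` comes.
  have hex : ∀ m (p : Pos (Bat.glue k x.tree y.tree) m), ∃ w : Pos C m,
      (∀ q, glueLeft k x.tree y.tree q = p → w = x.map.app m q) ∧
        ∀ q, glueRight k x.tree y.tree q = p → w = y.map.app m q := by
    intro m p
    rcases glue_cover k x.tree y.tree p with ⟨q, rfl⟩ | ⟨q, rfl⟩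
    · refine ⟨x.map.app m q, fun r hr => ?_, fun r hr => hov m q r hr.symm⟩
      rw [(glueLeftHom k x.tree y.tree).injective m hr]
    · refine ⟨y.map.app m q, fun r hr => (hov m r q hr).symm, fun r hr => ?_⟩
      rw [(glueRightHom k x.tree y.tree).injective m hr]
  choose f hl hr using hex
  have hl' := fun m q => hl m _ q rfl
  have hr' := fun m q => hr m _ q rfl
  have hd : (Bat.glue k x.tree y.tree).dim ≤ n := by
    refine Bat.dim_le_iff.2 fun m p => ?_
    rcases glue_cover k x.tree y.tree p with ⟨q, -⟩ | ⟨q, -⟩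
    · exact q.dim_le.trans x.dim_le
    · exact q.dim_le.trans y.dim_le
  refine ⟨⟨Bat.glue k x.tree y.tree, hd, ⟨f, fun {m} p => ?_, fun {m} p => ?_⟩⟩,
    hb, hd, _, hl', hr', rfl⟩
  · rcases glue_cover k x.tree y.tree p with ⟨q, rfl⟩ | ⟨q, rfl⟩
    · exact ((congrArg (f m) (glueLeft_src k _ _ q).symm).trans (hl' _ _)).trans
        ((x.map.app_src q).trans (congrArg Pos.src (hl' _ q).symm))
    · exact ((congrArg (f m) (glueRight_src k _ _ q).symm).trans (hr' _ _)).trans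
        ((y.map.app_src q).trans (congrArg Pos.src (hr' _ q).symm))
  · rcases glue_cover k x.tree y.tree p with ⟨q, rfl⟩ | ⟨q, rfl⟩
    · exact ((congrArg (f m) (glueLeft_tgt k _ _ q).symm).trans (hl' _ _)).trans
        ((x.map.app_tgt q).trans (congrArg Pos.tgt (hl' _ q).symm))
    · exact ((congrArg (f m) (glueRight_tgt k _ _ q).symm).trans (hr' _ _)).trans
        ((y.map.app_tgt q).trans (congrArg Pos.tgt (hr' _ q).symm))

theorem bd_true_of_isComposite (h : IsComposite k x y z) {j : ℕ} (hj : j ≤ k) :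
    z.supp.bd true j = y.supp.bd true j := by
  have hb := bd_eq_iff.2 h.1
  have hz := supp_of_isComposite h
  rw [sup_comm] at hz
  rw [hz]
  refine PosSet.bd_sup_of_le (e := true) y.supp_isTree x.supp_isTree (hz ▸ z.supp_isTree) hb.symm ?_ hj
  intro m p hy hx
  have := mem_bd_of_isComposite h hx hy
  rwa [hb] at this

theorem bd_false_of_isComposite (h : IsComposite k x y z) {j : ℕ} (hj : j ≤ k) :
    z.supp.bd false j = x.supp.bd false j := by
  have hz := supp_of_isComposite h
  rw [hz]
  exact PosSet.bd_sup_of_le (e := false) x.supp_isTree y.supp_isTree (hz ▸ z.supp_isTree)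
    (bd_eq_iff.2 h.1) (fun _ _ => mem_bd_of_isComposite h) hj

theorem bd_of_isComposite_of_lt (h : IsComposite k x y z) (e : Bool) {j : ℕ} (hj : k < j) :
    z.supp.bd e j = x.supp.bd e j ⊔ y.supp.bd e j := by
  rw [supp_of_isComposite h]
  exact PosSet.bd_sup_of_lt x.supp_isTree y.supp_isTree
    (fun _ _ hx hy => (mem_bd_of_isComposite h hx hy).2.1) e hj

end StrictCell

/-! ### Every tree is obtained from globes by gluing -/

/-- The trees obtained from globes by gluing. -/
inductive IsGluing : Bat → Prop
  | globe (m : ℕ) : IsGluing (globe m)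
  | glue (k : ℕ) (B C : Bat) (h : B.bd k = C.bd k) (hk : k < (Bat.glue k B C).dim) :
      IsGluing B → IsGluing C → IsGluing (Bat.glue k B C)

theorem IsGluing.cons_nil {B : Bat} (h : IsGluing B) : IsGluing (.cons B .nil) := by
  induction h with
  | globe m => exact .globe (m + 1)
  | glue k B C h hk _ _ hB hC =>
    refine .glue (k + 1) (.cons B .nil) (.cons C .nil) (congrArg (Bat.cons · .nil) h) ?_ hB hC
    exact lt_of_lt_of_le (Nat.succ_lt_succ hk) (le_max_left _ _)

/-- A tree is its suspended first branch glued along an object to the rest, and suspension raises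
the dimension of a gluing by one. The bound `k < dim` in `IsGluing` ensures that the resulting
composites of `n`-cells are along dimensions below `n`, as `map_composite` demands. -/
theorem isGluing : ∀ B : Bat, IsGluing B
  | .nil => .globe 0
  | .cons B L =>
    .glue 0 (.cons B .nil) L (Bat.bd_zero L).symm
      (lt_of_lt_of_le (Nat.succ_pos _) (le_max_left _ _)) (isGluing B).cons_nil (isGluing L)

theorem posCast_posCast_symm {B C : Bat} (h : B = C) {n : ℕ} (p : Pos C n) :
    posCast h (posCast h.symm p) = p := by
  subst h
  rfl

theorem StrictCell.isComposite_glue {D : Bat} {n : ℕ} {k : ℕ} {B C : Bat} (h : B.bd k = C.bd k)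
    (hd : (Bat.glue k B C).dim ≤ n) (hB : B.dim ≤ n) (hC : C.dim ≤ n)
    (f : GlobHom (Bat.glue k B C).glob D.glob) :
    IsComposite k (⟨B, hB, (glueLeftHom k B C).comp f⟩ : StrictCell D.glob n)
      ⟨C, hC, (glueRightHom k B C).comp f⟩ ⟨_, hd, f⟩ := by
  refine ⟨?_, hd, f, fun _ _ => rfl, fun _ _ => rfl, rfl⟩
  refine supp_injective (funext fun m => Set.ext fun p => ⟨?_, ?_⟩)
  · rintro ⟨z, rfl⟩
    exact ⟨posCast h z, congrArg (f.app m) (glueLeft_tgtIncl k B C h z).symm⟩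
  · rintro ⟨z, rfl⟩
    refine ⟨posCast h.symm z, congrArg (f.app m) ((glueLeft_tgtIncl k B C h _).trans ?_)⟩
    exact congrArg (fun w => glueRight k B C (srcIncl k C w)) (posCast_posCast_symm h z)

/-- Induction on the cells of the free strict `ω`-category on a tree: every cell is obtained from
globes by composition. -/
theorem StrictCell.induction {D : Bat} {n : ℕ} {P : StrictCell D.glob n → Prop}
    (hg : ∀ (m : ℕ) (hm : (GlobTheory.globe m).dim ≤ n)
      (f : GlobHom (GlobTheory.globe m).glob D.glob), P ⟨GlobTheory.globe m, hm, f⟩)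
    (hc : ∀ (k : ℕ) (x y z : StrictCell D.glob n), k < n → IsComposite k x y z → P x → P y → P z)
    (z : StrictCell D.glob n) : P z := by
  obtain ⟨T, hT, f⟩ := z
  induction isGluing T with
  | globe m => exact hg m hT f
  | glue k B C h hk _ _ ihB ihC =>
    have hB : B.dim ≤ n := Bat.dim_le_iff.2 fun m p => Bat.dim_le_iff.1 hT m (glueLeft k B C p)
    have hC : C.dim ≤ n := Bat.dim_le_iff.2 fun m p => Bat.dim_le_iff.1 hT m (glueRight k B C p)
    exact hc k _ _ _ (hk.trans_le hT) (isComposite_glue h hT hB hC f) (ihB _ _) (ihC _ _)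

/-! ### Globes and positions -/

/-- The top-dimensional position of the globe. -/
def topPos : (m : ℕ) → Pos (globe m) m
  | 0 => .here
  | m + 1 => .inl (topPos m)

theorem eq_topPos : ∀ {m : ℕ} (p : Pos (globe m) m), p = topPos m
  | 0, .here => rfl
  | _ + 1, .inl p => congrArg Pos.inl (eq_topPos p)
  | _ + 1, .inr q => nomatch q

theorem dim_globe_le : ∀ m : ℕ, (globe m).dim ≤ m
  | 0 => le_refl 0
  | m + 1 => max_le (Nat.succ_le_succ (dim_globe_le m)) (Nat.zero_le _)

/-- Every position of a globe is an iterated face of the top one. -/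
theorem globe_induction : ∀ {m : ℕ} {P : ∀ n, Pos (globe m) n → Prop}, P m (topPos m) →
    (∀ n p, P (n + 1) p → ∀ e, P n (p.face e)) → ∀ n p, P n p
  | 0, _, h, _, _, .here => h
  | m + 1, P, h, hf, n, p => by
    have key : ∀ n (p : Pos (globe m) n), P (n + 1) (Pos.inl p) :=
      globe_induction (P := fun n p => P (n + 1) (Pos.inl p)) h
        fun n p hp e => (congrArg (P (n + 1)) (Pos.face_inl (B := globe m) (L := .nil) e p)).mp
          (hf (n + 1) (.inl p) hp e)
    match n, p with
    | _, .here => exact hf 0 _ (key 0 .here) false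
    | _, .inl p => exact key _ p
    | _, .inr .here => exact hf 0 _ (key 0 .here) true

theorem globeHom_ext {m : ℕ} {C : Bat} {f g : GlobHom (globe m).glob C.glob}
    (h : f.app m (topPos m) = g.app m (topPos m)) : f = g := by
  refine GlobHom.ext (funext fun n => funext fun p => ?_)
  refine globe_induction (P := fun n p => f.app n p = g.app n p) h (fun n p hp e => ?_) n p
  exact (f.app_face e p).trans ((congrArg (Pos.face e) hp).trans (g.app_face e p).symm)

/-- The morphism from the point to the first object of a tree. -/
def nilHom (B : Bat) : GlobHom Bat.nil.glob B.glob where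
  app | _, .here => (.here : Pos B 0)
  app_src x := nomatch (x : Pos .nil _)
  app_tgt x := nomatch (x : Pos .nil _)

/-- The morphism out of a globe classifying a position. -/
def ofPos : {B : Bat} → {m : ℕ} → Pos B m → GlobHom (globe m).glob B.glob
  | B, _, .here => nilHom B
  | .cons _ L, _, .inl p => consMap (ofPos p) (nilHom L) rfl
  | .cons B L, _, .inr q => (ofPos q).comp (inrHom B L)

theorem ofPos_topPos : ∀ {B : Bat} {m : ℕ} (p : Pos B m), (ofPos p).app m (topPos m) = p
  | _, _, .here => rfl
  | .cons _ _, _, .inl p => congrArg Pos.inl (ofPos_topPos p)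
  | .cons _ _, _, .inr q => congrArg Pos.inr (ofPos_topPos q)

theorem eq_ofPos {m : ℕ} {C : Bat} (f : GlobHom (globe m).glob C.glob) :
    f = ofPos (f.app m (topPos m)) :=
  globeHom_ext (ofPos_topPos _).symm

/-- The generating cell of the free strict `ω`-category corresponding to a position. -/
def gen {B : Bat} {m : ℕ} (p : Pos B m) : StrictCell B.glob m := ⟨globe m, dim_globe_le m, ofPos p⟩

theorem mem_supp_gen {B : Bat} {m : ℕ} (p : Pos B m) : p ∈ (gen p).supp m :=
  ⟨topPos m, ofPos_topPos p⟩

theorem supp_gen_induction {B : Bat} {m : ℕ} {p : Pos B m} {P : ∀ n, Pos B n → Prop} (h : P m p)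
    (hf : ∀ n p, P (n + 1) p → ∀ e, P n (p.face e)) {n : ℕ} {q : Pos B n}
    (hq : q ∈ (gen p).supp n) : P n q := by
  obtain ⟨r, rfl⟩ := hq
  refine globe_induction (P := fun n r => P n ((ofPos p).app n r)) (by rwa [ofPos_topPos])
    (fun n r hr e => ?_) n r
  have := hf _ _ hr e
  rwa [← (ofPos p).app_face] at this

/-- Besides `p`, the support of `gen p` contains the support of `p.face e` and the opposite face; by
globularity all lower faces are shared. Passing to the boundary discards `p` and the opposite face.
-/
theorem supp_gen_face {B : Bat} {m : ℕ} (p : Pos B (m + 1)) (e : Bool) :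
    (gen (p.face e)).supp = (gen p).supp.bd e m := by
  have hT := (gen p).supp_isTree
  ext n q
  constructor
  · refine supp_gen_induction (P := fun n q => q ∈ (gen p).supp.bd e m n) ⟨?_, le_rfl, ?_⟩ ?_
    · exact hT.face_mem e (mem_supp_gen p)
    · rintro - _ ⟨r, rfl⟩ hr
      rw [eq_topPos r] at hr
      have hp : (gen p).map.app (m + 1) (topPos (m + 1)) = p := ofPos_topPos p
      exact p.face_ne e (hr.symm.trans (congrArg (Pos.face !e) hp))
    · intro n q hq d
      rw [← StrictCell.supp_bdAt] at hq ⊢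
      exact ((gen p).bdAt e m).supp_isTree.face_mem d hq
  · rintro ⟨hq, hn, h⟩
    have := supp_gen_induction (P := fun n q => (∃ h : n = m + 1, h ▸ q = p) ∨
      q ∈ (gen (p.face e)).supp n ∨ ∃ h : n = m, h ▸ q = p.face !e) (Or.inl ⟨rfl, rfl⟩) ?_ hq
    · rcases this with ⟨rfl, -⟩ | h1 | ⟨rfl, rfl⟩
      · omega
      · exact h1
      · exact absurd rfl (h rfl p (mem_supp_gen p))
    · rintro n q (⟨hn, h1⟩ | h1 | ⟨rfl, rfl⟩) d
      · obtain rfl : n = m := by omega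
        obtain rfl : q = p := h1
        by_cases hd : d = e
        · subst hd
          exact Or.inr (Or.inl (mem_supp_gen _))
        · obtain rfl : d = !e := by cases d <;> cases e <;> simp_all
          exact Or.inr (Or.inr ⟨rfl, rfl⟩)
      · exact Or.inr (Or.inl ((gen (p.face e)).supp_isTree.face_mem d h1))
      · refine Or.inr (Or.inl ?_)
        have := (gen (p.face e)).supp_isTree.face_mem d (mem_supp_gen (p.face e))
        rwa [Pos.face_face] at this

/-! ### Strict `ω`-functors out of the free strict `ω`-category on a tree -/

/-- The union of the values at the elements of `U` of a map with values in sets of positions. -/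
def PosSet.bind {B C : Bat} (τ : ∀ m, Pos B m → PosSet C) (U : PosSet B) : PosSet C :=
  fun n => {w | ∃ (m : ℕ) (p : Pos B m), p ∈ U m ∧ w ∈ τ m p n}

theorem PosSet.bind_sup {B C : Bat} (τ : ∀ m, Pos B m → PosSet C) (U V : PosSet B) :
    (U ⊔ V).bind τ = U.bind τ ⊔ V.bind τ := by
  ext n w
  constructor
  · rintro ⟨m, p, hp | hp, hw⟩
    · exact Or.inl ⟨m, p, hp, hw⟩
    · exact Or.inr ⟨m, p, hp, hw⟩
  · rintro (⟨m, p, hp, hw⟩ | ⟨m, p, hp, hw⟩)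
    · exact ⟨m, p, Or.inl hp, hw⟩
    · exact ⟨m, p, Or.inr hp, hw⟩

theorem StrictCell.bd_supp_of_le {B : Bat} {n k : ℕ} (x : StrictCell B.glob n) (hk : n ≤ k)
    (e : Bool) : x.supp.bd e k = x.supp :=
  PosSet.bd_of_le x.le_of_mem_supp hk e

section extend

variable {B C : Bat} (τ : GlobHom B.glob (strictFree C.glob))

/-- The sets of positions that occur in the values of `τ`. -/
def GlobHom.suppMap : ∀ m, Pos B m → PosSet C := fun m p => (τ.app m p : StrictCell C.glob m).supp

theorem GlobHom.suppMap_face (e : Bool) {m : ℕ} (p : Pos B (m + 1)) :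
    τ.suppMap m (p.face e) = (τ.suppMap (m + 1) p).bd e m := by
  refine Eq.trans ?_ (StrictCell.supp_bdAt e m (τ.app (m + 1) p))
  cases e
  · exact congrArg StrictCell.supp (τ.app_src p)
  · exact congrArg StrictCell.supp (τ.app_tgt p)

theorem GlobHom.bind_supp_gen {m : ℕ} (p : Pos B m) :
    (gen p).supp.bind τ.suppMap = τ.suppMap m p := by
  ext n w
  constructor
  · rintro ⟨l, q, hq, hw⟩
    refine supp_gen_induction (P := fun l q => τ.suppMap l q n ⊆ τ.suppMap m p n) subset_rfl
      (fun l q hq e => ?_) hq hw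
    rw [GlobHom.suppMap_face]
    exact fun w hw => hq hw.1
  · exact fun hw => ⟨m, p, mem_supp_gen p, hw⟩

/-- Induction on the dimension `m + 1` of the position: for `k < m` pass to a face, for `k = m` use
that `τ` respects faces, and for `k > m` taking boundaries changes nothing. -/
theorem GlobHom.bind_bd_supp_gen (e : Bool) (k : ℕ) : ∀ {m : ℕ} (p : Pos B m),
    ((gen p).supp.bd e k).bind τ.suppMap = (τ.suppMap m p).bd e k := by
  intro m
  induction m with
  | zero =>
    intro p
    rw [(gen p).bd_supp_of_le (Nat.zero_le k), τ.bind_supp_gen]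
    exact ((τ.app 0 p : StrictCell C.glob 0).bd_supp_of_le (Nat.zero_le k) e).symm
  | succ m ih =>
    intro p
    rcases lt_trichotomy k m with hk | rfl | hk
    · rw [← (gen p).supp_isTree.bd_bd e hk, ← supp_gen_face, ih (p.face e), τ.suppMap_face]
      exact (StrictCell.supp_isTree (τ.app (m + 1) p)).bd_bd e hk
    · rw [← supp_gen_face, τ.bind_supp_gen, τ.suppMap_face]
    · rw [(gen p).bd_supp_of_le hk, τ.bind_supp_gen]
      exact ((τ.app (m + 1) p : StrictCell C.glob (m + 1)).bd_supp_of_le hk e).symm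

/-- The boundary formula belongs to the induction: it makes the images of composable cells
composable, and it passes to composites because boundaries of composites are computed from those of
the factors in the same way on both sides. -/
theorem GlobHom.exists_extend {n : ℕ} (x : StrictCell B.glob n) :
    ∃ y : StrictCell C.glob n, y.supp = x.supp.bind τ.suppMap ∧
      ∀ e k, y.supp.bd e k = (x.supp.bd e k).bind τ.suppMap := by
  induction x using StrictCell.induction with
  | hg m hm f =>
    have hmn : m ≤ n := (topPos m).dim_le.trans hm
    obtain ⟨p, rfl⟩ : ∃ p : Pos B m, f = ofPos p := ⟨_, eq_ofPos f⟩
    obtain ⟨y, hy⟩ := StrictCell.exists_supp_eq (n := n) (StrictCell.supp_isTree (τ.app m p))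
      (fun l q hq => (StrictCell.le_of_mem_supp _ l q hq).trans hmn)
    exact ⟨y, hy.trans (τ.bind_supp_gen p).symm,
      fun e k => (congrArg (PosSet.bd e k) hy).trans (τ.bind_bd_supp_gen e k p).symm⟩
  | hc k x y z hk h hx hy =>
    obtain ⟨x', hx, hx'⟩ := hx
    obtain ⟨y', hy, hy'⟩ := hy
    have hb : x'.supp.bd true k = y'.supp.bd false k := by
      rw [hx', hy', StrictCell.bd_eq_iff.2 h.1]
    obtain ⟨z', h'⟩ := StrictCell.exists_isComposite hb
    refine ⟨z', ?_, fun e j => ?_⟩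
    · rw [StrictCell.supp_of_isComposite h, StrictCell.supp_of_isComposite h', hx, hy,
        PosSet.bind_sup]
    · rcases le_or_gt j k with hj | hj
      · cases e
        · rw [StrictCell.bd_false_of_isComposite h hj, StrictCell.bd_false_of_isComposite h' hj,
            hx']
        · rw [StrictCell.bd_true_of_isComposite h hj, StrictCell.bd_true_of_isComposite h' hj, hy']
      · rw [StrictCell.bd_of_isComposite_of_lt h e hj, StrictCell.bd_of_isComposite_of_lt h' e hj,
          hx', hy', PosSet.bind_sup]

/-- The value at a cell of the extension of `τ`. -/
noncomputable def extendApp {n : ℕ} (x : StrictCell B.glob n) : StrictCell C.glob n :=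
  (τ.exists_extend x).choose

theorem supp_extendApp {n : ℕ} (x : StrictCell B.glob n) :
    (extendApp τ x).supp = x.supp.bind τ.suppMap :=
  (τ.exists_extend x).choose_spec.1

theorem bd_extendApp {n : ℕ} (x : StrictCell B.glob n) (e : Bool) (k : ℕ) :
    (extendApp τ x).supp.bd e k = (x.supp.bd e k).bind τ.suppMap :=
  (τ.exists_extend x).choose_spec.2 e k

theorem extendApp_bdAt {n : ℕ} (x : StrictCell B.glob n) (e : Bool) (k : ℕ) :
    extendApp τ (x.bdAt e k) = (extendApp τ x).bdAt e k := by
  refine StrictCell.supp_injective ?_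
  rw [supp_extendApp, StrictCell.supp_bdAt, StrictCell.supp_bdAt, bd_extendApp]

/-- The extension of a morphism of globular sets to a strict `ω`-functor. -/
noncomputable def extend : StrictFunctor B.glob C.glob where
  hom :=
    { app := fun _ => extendApp τ
      app_src := fun {n} x => extendApp_bdAt τ x false n
      app_tgt := fun {n} x => extendApp_bdAt τ x true n }
  map_ident {n} x := by
    refine StrictCell.supp_injective ?_
    change (extendApp τ x.ident).supp = (extendApp τ x).supp
    rw [supp_extendApp, supp_extendApp]
    rfl
  map_composite {k n} hk x y z h := by
    change IsComposite k (extendApp τ x) (extendApp τ y) (extendApp τ z)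
    have hb : (extendApp τ x).supp.bd true k = (extendApp τ y).supp.bd false k := by
      rw [bd_extendApp, bd_extendApp, StrictCell.bd_eq_iff.2 h.1]
    obtain ⟨z', h'⟩ := StrictCell.exists_isComposite hb
    have : extendApp τ z = z' := by
      refine StrictCell.supp_injective ?_
      rw [StrictCell.supp_of_isComposite h', supp_extendApp, supp_extendApp, supp_extendApp,
        StrictCell.supp_of_isComposite h, PosSet.bind_sup]
    rwa [this]

theorem extend_gen {m : ℕ} (p : Pos B m) : (extend τ).hom.app m (gen p) = τ.app m p :=
  StrictCell.supp_injective ((supp_extendApp τ (gen p)).trans (τ.bind_supp_gen p))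

end extend

/-- Every cell is composed from globes, and a globe in a higher dimension is an iterated identity on
a generator. -/
theorem StrictFunctor.ext_gen {B C : Bat} {F G : StrictFunctor B.glob C.glob}
    (h : ∀ m (p : Pos B m), F.hom.app m (gen p) = G.hom.app m (gen p)) : F = G := by
  refine StrictFunctor.ext (GlobHom.ext (funext fun n => funext fun x => ?_))
  change StrictCell B.glob n at x
  induction x using StrictCell.induction with
  | hg m hm f =>
    have hmn : m ≤ n := (topPos m).dim_le.trans hm
    induction n, hmn using Nat.le_induction with
    | base =>
      rw [eq_ofPos f]
      exact h m _
    | succ n hn ih =>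
      have := ih ((dim_globe_le m).trans hn)
      exact (F.map_ident _).trans ((congrArg StrictCell.ident this).trans (G.map_ident _).symm)
  | hc k x y z hk hz hx hy =>
    refine StrictCell.supp_injective ?_
    have h1 := StrictCell.supp_of_isComposite (F.map_composite hk x y z hz)
    have h2 := StrictCell.supp_of_isComposite (G.map_composite hk x y z hz)
    exact h1.trans ((congrArg₂ (fun a b : StrictCell C.glob n => a.supp ⊔ b.supp) hx hy).trans
      h2.symm)

/-! ### Values on generators and supports of strict functors -/

theorem gen_face {B : Bat} {m : ℕ} (p : Pos B (m + 1)) (e : Bool) :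
    gen (p.face e) = (gen p).bdAt e m := by
  refine StrictCell.supp_injective ?_
  rw [supp_gen_face, StrictCell.supp_bdAt]

theorem GlobHom.gen_app {B C : Bat} (f : GlobHom B.glob C.glob) {m : ℕ} (p : Pos B m) :
    gen (f.app m p : Pos C m) = (strictFreeMap f).hom.app m (gen p) := by
  have : ofPos (f.app m p : Pos C m) = (ofPos p).comp f :=
    globeHom_ext ((ofPos_topPos _).trans (congrArg (f.app m) (ofPos_topPos p)).symm)
  change (⟨globe m, _, ofPos (f.app m p)⟩ : StrictCell C.glob m) = ⟨globe m, _, _⟩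
  rw [this]
  rfl

/-- The values of a strict `ω`-functor on generators. -/
def StrictFunctor.genHom {B C : Bat} (F : StrictFunctor B.glob C.glob) :
    GlobHom B.glob (strictFree C.glob) where
  app m p := F.hom.app m (gen p)
  app_src p := (congrArg (F.hom.app _) (gen_face p false)).trans (F.hom.app_src (gen p))
  app_tgt p := (congrArg (F.hom.app _) (gen_face p true)).trans (F.hom.app_tgt (gen p))

/-- The support of a strict `ω`-functor. -/
def StrictFunctor.supp {B C : Bat} (F : StrictFunctor B.glob C.glob) : PosSet C :=
  PosSet.bind F.genHom.suppMap fun _ => Set.univ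

/-- The cell of a tree that consists of all positions. -/
def topCell (B : Bat) {n : ℕ} (h : B.dim ≤ n) : StrictCell B.glob n := ⟨B, h, GlobHom.id _⟩

theorem supp_topCell (B : Bat) {n : ℕ} (h : B.dim ≤ n) :
    (topCell B h).supp = fun _ => Set.univ :=
  funext fun _ => Set.range_id

/-- The support is that of a single cell, the value at the top cell of `B` of the extension of
`F.genHom`. -/
theorem StrictFunctor.supp_isTree {B C : Bat} (F : StrictFunctor B.glob C.glob) :
    F.supp.IsTree := by
  have := (extendApp F.genHom (topCell B le_rfl)).supp_isTree
  rwa [supp_extendApp, supp_topCell] at this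

/-! ### Factorizations detected by supports -/

theorem Theta0.eq_of_range_eq {B B' C : Theta0} (i : B ⟶ C) (i' : B' ⟶ C)
    (h : ∀ n, Set.range (i.app n) = Set.range (i'.app n)) :
    (⟨B, i⟩ : Σ B : Theta0, B ⟶ C) = ⟨B', i'⟩ :=
  GlobHom.eq_of_range_eq i i' h

section fac

universe v u

variable {A : Type u} [Category.{v} A] {j : Theta0 ⥤ A}

theorem IsImmersion.exists_map (hj : Function.Injective j.obj) {Z : A} {C : Theta0}
    {i : Z ⟶ j.obj C} (hi : IsImmersion j i) :
    ∃ (B : Theta0) (h : Z = j.obj B) (f : B ⟶ C), i = eqToHom h ≫ j.map f := by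
  obtain ⟨B, C', f, h⟩ := hi
  obtain rfl : j.obj B = Z := congrArg Comma.left h
  obtain rfl : C' = C := hj (congrArg Comma.right h)
  refine ⟨B, rfl, f, ?_⟩
  rw [eqToHom_refl, Category.id_comp]
  exact ((Arrow.mk_inj _ _).1 h).symm

/-- A notion of support for the morphisms of a theory, in terms of which factorizations through
immersions can be decided. -/
structure SupportData (j : Theta0 ⥤ A)
    (supp : ∀ {X : A} {C : Theta0}, (X ⟶ j.obj C) → PosSet C) : Prop where
  injective_obj : Function.Injective j.obj
  surjective_obj : Function.Surjective j.obj
  isTree : ∀ {X : A} {C : Theta0} (f : X ⟶ j.obj C), (supp f).IsTree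
  supp_comp : ∀ {X : A} {B C : Theta0} (g : X ⟶ j.obj B) (i : B ⟶ C) (n : ℕ),
    supp (g ≫ j.map i) n = i.app n '' supp g n
  exists_fac : ∀ {X : A} {B C : Theta0} (f : X ⟶ j.obj C) (i : B ⟶ C),
    (∀ n, supp f n ⊆ Set.range (i.app n)) → ∃ g, g ≫ j.map i = f
  cancel : ∀ {X : A} {B C : Theta0} (g g' : X ⟶ j.obj B) (i : B ⟶ C),
    g ≫ j.map i = g' ≫ j.map i → g = g'

namespace SupportData

variable {supp : ∀ {X : A} {C : Theta0}, (X ⟶ j.obj C) → PosSet C} (D : SupportData j supp)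
include D

theorem exists_image {X : A} {C : Theta0} (f : X ⟶ j.obj C) :
    ∃ (T : Theta0) (i : T ⟶ C), ∀ n, supp f n = Set.range (i.app n) :=
  D.isTree f

/-- A cover factors through the image of its support, which must then be everything. Conversely, an
immersion through which a morphism of full support factors is surjective, hence an identity. -/
theorem isCover_iff [j.Faithful] {X : A} {C : Theta0} (f : X ⟶ j.obj C) :
    IsCover j f ↔ ∀ n p, p ∈ supp f n := by
  constructor
  · intro hf n p
    obtain ⟨T, i, hi⟩ := D.exists_image f
    obtain ⟨g, hg⟩ := D.exists_fac f i fun n => (hi n).subset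
    obtain ⟨h, h'⟩ := hf g (j.map i) ⟨T, C, i, rfl⟩ hg
    obtain rfl : T = C := D.injective_obj h
    have : i = 𝟙 T := j.map_injective (by rw [h', eqToHom_refl, j.map_id])
    rw [hi, this]
    exact ⟨p, rfl⟩
  · intro hf Z g i hi hgi
    obtain ⟨B, rfl, i, rfl⟩ := hi.exists_map D.injective_obj
    rw [eqToHom_refl, Category.id_comp] at hgi ⊢
    subst hgi
    have hs : ∀ n, Function.Surjective (i.app n) := fun n p => by
      have := hf n p
      rw [D.supp_comp] at this
      obtain ⟨q, -, hq⟩ := this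
      exact ⟨q, hq⟩
    have := Theta0.eq_of_range_eq i (𝟙 C) fun n => (hs n).range_eq.trans Set.range_id.symm
    obtain rfl : B = C := congrArg Sigma.fst this
    obtain rfl : i = 𝟙 B := eq_of_heq (Sigma.mk.inj this).2
    exact ⟨rfl, j.map_id B⟩

/-- Since covers have full support, the immersion must have the support of `f` as its image.
Rigidity then fixes the immersion, and cancellation fixes the cover. -/
theorem existsUnique_fac [j.Faithful] {X Y : A} (f : X ⟶ Y) :
    ∃! t : (Z : A) × (X ⟶ Z) × (Z ⟶ Y),
      IsCover j t.2.1 ∧ IsImmersion j t.2.2 ∧ t.2.1 ≫ t.2.2 = f := by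
  obtain ⟨C, rfl⟩ := D.surjective_obj Y
  obtain ⟨T, i, hi⟩ := D.exists_image f
  obtain ⟨g, rfl⟩ := D.exists_fac f i fun n => (hi n).subset
  refine ⟨⟨j.obj T, g, j.map i⟩, ⟨?_, ⟨T, C, i, rfl⟩, rfl⟩, ?_⟩
  · refine (D.isCover_iff g).2 fun n p => ?_
    have : i.app n p ∈ supp (g ≫ j.map i) n := hi n ▸ Set.mem_range_self p
    rw [D.supp_comp] at this
    obtain ⟨q, hq, hqp⟩ := this
    exact GlobHom.injective i n hqp ▸ hq
  · rintro ⟨Z, g', i'⟩ ⟨hg', hi', h⟩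
    dsimp only at hg' hi' h
    obtain ⟨B, rfl, i', rfl⟩ := hi'.exists_map D.injective_obj
    simp only [eqToHom_refl, Category.id_comp] at hg' h ⊢
    rw [D.isCover_iff] at hg'
    have hr : ∀ n, Set.range (i'.app n) = Set.range (i.app n) := fun n => by
      rw [← hi, ← h, D.supp_comp, Set.eq_univ_of_forall (hg' n)]
      exact Set.image_univ.symm
    have := Theta0.eq_of_range_eq i' i hr
    obtain rfl : B = T := congrArg Sigma.fst this
    obtain rfl : i' = i := eq_of_heq (Sigma.mk.inj this).2
    rw [D.cancel _ _ _ h]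

end SupportData

end fac

/-! ### Globular sums of globes -/

/-- The leftmost leaf of a tree, as a position. -/
inductive Pos.IsLeft : {B : Bat} → {n : ℕ} → Pos B n → Prop
  | here : Pos.IsLeft (.here : Pos .nil 0)
  | inl {B L : Bat} {n : ℕ} {p : Pos B n} : Pos.IsLeft p → Pos.IsLeft (.inl p : Pos (.cons B L) _)

theorem isLeft_topPos : ∀ m : ℕ, (topPos m).IsLeft
  | 0 => .here
  | m + 1 => .inl (isLeft_topPos m)

/-- Gluing a globe to the left of a tree. -/
theorem exists_prepend : ∀ (m n n₀ : ℕ) (hn : m < n) (hn₀ : m < n₀) {T : Bat} (p₀ : Pos T n₀),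
    p₀.IsLeft → ∃ (Z : Bat) (l : GlobHom (globe n).glob Z.glob) (r : GlobHom T.glob Z.glob),
      Pos.IsLeft (l.app n (topPos n)) ∧
      (∀ (k : ℕ) (z : Pos (globe m) k), l.app k (cotgtPos m n hn.le z) =
        r.app k ((ofPos p₀).app k (cosrcPos m n₀ hn₀.le z))) ∧
      (∀ (k : ℕ) (p : Pos Z k), (∃ x, l.app k x = p) ∨ ∃ y, r.app k y = p) ∧
      ∀ (k : ℕ) (x : Pos (globe n) k) (y : Pos T k), l.app k x = r.app k y →
        ∃ z, cotgtPos m n hn.le z = x ∧ (ofPos p₀).app k (cosrcPos m n₀ hn₀.le z) = y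
  -- Gluing along an object: the globe becomes a new branch before all the others.
  | 0, n + 1, n₀ + 1, _, _, _, _, .inl (B := B) (L := L) (p := p₀) _ => by
    refine ⟨.cons (globe n) (.cons B L), consMap (GlobHom.id _) (nilHom _) rfl, inrHom _ _,
      .inl (isLeft_topPos n), ?_, ?_, ?_⟩
    · rintro _ ⟨⟩
      rfl
    · rintro k (_ | p | q)
      · exact .inl ⟨Pos.here, rfl⟩
      · exact .inl ⟨Pos.inl p, rfl⟩
      · exact .inr ⟨q, rfl⟩
    · rintro k (_ | x | q) y h
      · cases h
      · cases h
      · cases q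
        obtain rfl := Pos.inr.inj h
        exact ⟨.here, rfl, rfl⟩
  -- Here the gluing takes place inside the first branch, which contains the leftmost leaf.
  | m + 1, n + 1, n₀ + 1, hn, hn₀, _, _, .inl (B := B) (L := L) (p := p₀) hp₀ => by
    obtain ⟨Z, l, r, hl, hc, hcov, hov⟩ := exists_prepend m n n₀ (Nat.lt_of_succ_lt_succ hn)
      (Nat.lt_of_succ_lt_succ hn₀) p₀ hp₀
    refine ⟨.cons Z L, consMap l (nilHom L) rfl, consMap r (GlobHom.id L.glob) rfl, .inl hl,
      ?_, ?_, ?_⟩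
    · rintro _ (_ | z | ⟨⟩)
      · rfl
      · exact congrArg Pos.inl (hc _ z)
      · rfl
    · rintro k (_ | p | q)
      · exact .inl ⟨Pos.here, rfl⟩
      · exact (hcov _ p).imp (fun ⟨x, h⟩ => ⟨Pos.inl x, congrArg Pos.inl h⟩)
          (fun ⟨x, h⟩ => ⟨Pos.inl x, congrArg Pos.inl h⟩)
      · exact .inr ⟨Pos.inr q, rfl⟩
    · rintro k (_ | x | q) y h
      · rcases y with _ | y | y
        · exact ⟨.here, rfl, rfl⟩
        · cases h
      · rcases y with _ | y | y
        · obtain ⟨z, h1, h2⟩ := hov _ x y (Pos.inl.inj h)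
          exact ⟨.inl z, congrArg Pos.inl h1, congrArg Pos.inl h2⟩
        · cases h
      · cases q
        rcases y with _ | y
        · cases h
        · obtain rfl := Pos.inr.inj h
          exact ⟨.inr .here, rfl, rfl⟩

universe u

/-- The positions of `Z` are the colimit, in every dimension, of the positions of the globes of the
table `G`. -/
structure IsPosSum (G : DimTable) (Z : Bat)
    (a : ∀ i : Fin (G.r + 1), GlobHom (globe (G.top i)).glob Z.glob) : Prop where
  cover : ∀ (k : ℕ) (p : Pos Z k), ∃ i x, (a i).app k x = p
  cocone : ∀ (i : Fin G.r) (k : ℕ) (z : Pos (globe (G.bot i)) k),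
    (a i.castSucc).app k (cotgtPos _ _ (G.lt_left i).le z) =
      (a i.succ).app k (cosrcPos _ _ (G.lt_right i).le z)
  desc : ∀ (W : ℕ → Type u) (b : ∀ i k, Pos (globe (G.top i)) k → W k),
    (∀ (i : Fin G.r) (k : ℕ) (z : Pos (globe (G.bot i)) k),
      b i.castSucc k (cotgtPos _ _ (G.lt_left i).le z) =
        b i.succ k (cosrcPos _ _ (G.lt_right i).le z)) →
    ∃ h : ∀ k, Pos Z k → W k, ∀ i k x, h k ((a i).app k x) = b i k x

/-- The table without its first globe. -/
def DimTable.tail (r : ℕ) (top : Fin (r + 2) → ℕ) (bot : Fin (r + 1) → ℕ)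
    (hl : ∀ i : Fin (r + 1), bot i < top i.castSucc) (hr : ∀ i : Fin (r + 1), bot i < top i.succ) :
    DimTable where
  r := r
  top i := top i.succ
  bot i := bot i.succ
  lt_left i := hl i.succ
  lt_right i := hr i.succ

/-- A family on the longer table is glued from its first component and a map descended to `T`. By
`hov` these overlap only in the globe of dimension `bot 0`, where they agree. -/
theorem IsPosSum.prepend {r : ℕ} {top : Fin (r + 2) → ℕ} {bot : Fin (r + 1) → ℕ}
    {hl : ∀ i : Fin (r + 1), bot i < top i.castSucc} {hr : ∀ i : Fin (r + 1), bot i < top i.succ}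
    {T : Bat} {a : ∀ i : Fin (r + 1), GlobHom (globe (top i.succ)).glob T.glob}
    (ha : IsPosSum.{u} (DimTable.tail r top bot hl hr) T a) {Z : Bat}
    {l : GlobHom (globe (top 0)).glob Z.glob} {f : GlobHom T.glob Z.glob}
    (hc : ∀ (k : ℕ) (z : Pos (globe (bot 0)) k), l.app k (cotgtPos _ _ (hl 0).le z) =
      f.app k ((a 0).app k (cosrcPos _ _ (hr 0).le z)))
    (hcov : ∀ (k : ℕ) (p : Pos Z k), (∃ x, l.app k x = p) ∨ ∃ y, f.app k y = p)
    (hov : ∀ (k : ℕ) (x : Pos (globe (top 0)) k) (y : Pos T k), l.app k x = f.app k y →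
      ∃ z, cotgtPos _ _ (hl 0).le z = x ∧ (a 0).app k (cosrcPos _ _ (hr 0).le z) = y) :
    IsPosSum.{u} ⟨r + 1, top, bot, hl, hr⟩ Z
      (Fin.cons (α := fun i => GlobHom (globe (top i)).glob Z.glob) l fun i => (a i).comp f) where
  cover k p := by
    rcases hcov k p with ⟨x, rfl⟩ | ⟨y, rfl⟩
    · exact ⟨0, x, rfl⟩
    · obtain ⟨i, x, rfl⟩ := ha.cover k y
      exact ⟨i.succ, x, rfl⟩
  cocone i k z := by
    cases i using Fin.cases with
    | zero => exact hc k z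
    | succ i => exact congrArg (f.app k) (ha.cocone i k z)
  desc W b hb := by
    obtain ⟨h, hh⟩ := ha.desc W (fun i => b i.succ) fun i => hb i.succ
    have hcons : ∀ (k : ℕ) (x : Pos (globe (top 0)) k) (y : Pos T k), l.app k x = f.app k y →
        b 0 k x = h k y := by
      intro k x y hxy
      obtain ⟨z, rfl, rfl⟩ := hov k x y hxy
      exact (hb 0 k z).trans (hh 0 k _).symm
    have hex : ∀ (k : ℕ) (p : Pos Z k), ∃ w : W k,
        (∀ x, l.app k x = p → w = b 0 k x) ∧ ∀ y, f.app k y = p → w = h k y := by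
      intro k p
      rcases hcov k p with ⟨x, rfl⟩ | ⟨y, rfl⟩
      · refine ⟨b 0 k x, fun x' hx' => ?_, fun y hy => hcons k x y hy.symm⟩
        rw [l.injective k hx']
      · refine ⟨h k y, fun x hx => (hcons k x y hx).symm, fun y' hy' => ?_⟩
        rw [f.injective k hy']
    choose g hg1 hg2 using hex
    refine ⟨g, fun i k x => ?_⟩
    cases i using Fin.cases with
    | zero => exact hg1 k _ x rfl
    | succ i => exact (hg2 k _ _ rfl).trans (hh i k x)

/-- The sum is built from the right; tracking the leftmost leaf allows the next globe to be
prepended. -/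
theorem exists_isPosSum : ∀ (r : ℕ) (top : Fin (r + 1) → ℕ) (bot : Fin r → ℕ)
    (hl : ∀ i : Fin r, bot i < top i.castSucc) (hr : ∀ i : Fin r, bot i < top i.succ),
    ∃ (Z : Bat) (a : ∀ i : Fin (r + 1), GlobHom (globe (top i)).glob Z.glob),
      Pos.IsLeft ((a 0).app _ (topPos _)) ∧ IsPosSum.{0} ⟨r, top, bot, hl, hr⟩ Z a ∧
        IsPosSum.{1} ⟨r, top, bot, hl, hr⟩ Z a
  | 0, top, bot, hl, hr => by
    have h1 : ∀ i : Fin 1, i = 0 := fun i => Subsingleton.elim _ _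
    refine ⟨globe (top 0), fun i => h1 i ▸ GlobHom.id _, isLeft_topPos _, ?_, ?_⟩
    all_goals
      refine ⟨fun k p => ⟨0, p, rfl⟩, fun i => i.elim0, fun W b hb => ⟨b 0, fun i k x => ?_⟩⟩
      obtain rfl := h1 i
      rfl
  | r + 1, top, bot, hl, hr => by
    obtain ⟨T, a, ha, ha0, ha1⟩ := exists_isPosSum r (fun i => top i.succ) (fun i => bot i.succ)
      (fun i => hl i.succ) (fun i => hr i.succ)
    obtain ⟨Z, l, f, hlf, hc, hcov, hov⟩ := exists_prepend _ _ _ (hl 0) (hr 0) _ ha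
    rw [← eq_ofPos (a 0)] at hc hov
    exact ⟨Z, _, hlf, IsPosSum.prepend ha0 hc hcov hov, IsPosSum.prepend ha1 hc hcov hov⟩

theorem IsPosSum.desc_face {G : DimTable} {Z : Bat}
    {a : ∀ i : Fin (G.r + 1), GlobHom (globe (G.top i)).glob Z.glob} (ha : IsPosSum.{u} G Z a)
    {W : ℕ → Type*} {s : ∀ n, W (n + 1) → W n} {b : ∀ i k, Pos (globe (G.top i)) k → W k} (e : Bool)
    (hb : ∀ i k x, b i k (Pos.face e x) = s k (b i (k + 1) x)) {h : ∀ k, Pos Z k → W k}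
    (hh : ∀ i k x, h k ((a i).app k x) = b i k x) (k : ℕ) (p : Pos Z (k + 1)) :
    h k (p.face e) = s k (h (k + 1) p) := by
  obtain ⟨i, x, rfl⟩ := ha.cover (k + 1) p
  rw [hh]
  exact (congrArg (h k) ((a i).app_face e x).symm).trans ((hh i k _).trans (hb i k x))

theorem IsPosSum.isGlobSum {G : DimTable} {Z : Theta0}
    {a : ∀ i : Fin (G.r + 1), Theta0.globe (G.top i) ⟶ Z} (ha : IsPosSum.{0} G Z a) :
    IsGlobSum (𝟭 Theta0) G Z a := by
  refine ⟨fun i => GlobHom.ext (funext fun k => funext fun z => ha.cocone i k z),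
    fun W b hb => ?_⟩
  obtain ⟨h, hh⟩ := ha.desc (fun k => Pos W k) (fun i => (b i).app)
    fun i k z => congrFun (congrFun (congrArg GlobHom.app (hb i)) k) z
  refine ⟨⟨h, fun {n} x => ?_, fun {n} x => ?_⟩,
    fun i => GlobHom.ext (funext fun k => funext fun z => hh i k z), fun g hg => ?_⟩
  · exact ha.desc_face (s := fun _ => Pos.src) false (fun i k x => (b i).app_src x) hh n x
  · exact ha.desc_face (s := fun _ => Pos.tgt) true (fun i k x => (b i).app_tgt x) hh n x
  · refine GlobHom.ext (funext fun k => funext fun p => ?_)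
    obtain ⟨i, x, rfl⟩ := ha.cover k p
    exact (congrFun (congrFun (congrArg GlobHom.app (hg i)) k) x).trans (hh i k x).symm

/-- The comparison from the explicit sum has a section, so it is a surjective map of trees, hence an
identity. The positionwise description therefore transfers to every globular sum. -/
theorem IsGlobSum.isPosSum {G : DimTable} {Z : Theta0}
    {a : ∀ i : Fin (G.r + 1), Theta0.globe (G.top i) ⟶ Z} (ha : IsGlobSum (𝟭 Theta0) G Z a) :
    IsPosSum.{0} G Z a ∧ IsPosSum.{1} G Z a := by
  obtain ⟨Z', a', -, h0, h1⟩ := exists_isPosSum G.r G.top G.bot G.lt_left G.lt_right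
  change Theta0 at Z'
  change ∀ i : Fin (G.r + 1), Theta0.globe (G.top i) ⟶ Z' at a'
  change IsPosSum G Z' a' at h0 h1
  obtain ⟨f, hf, -⟩ := h0.isGlobSum.2 Z a ha.1
  obtain ⟨g, hg, -⟩ := ha.2 Z' a' h0.isGlobSum.1
  have hfg : g ≫ f = 𝟙 Z := (ha.2 Z a ha.1).unique
    (fun i => by rw [← Category.assoc, hg, hf]) (fun i => Category.comp_id _)
  have hs : ∀ n, Function.Surjective (f.app n) := fun n p =>
    ⟨g.app n p, congrFun (congrFun (congrArg GlobHom.app hfg) n) p⟩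
  have := Theta0.eq_of_range_eq f (𝟙 Z) fun n => (hs n).range_eq.trans Set.range_id.symm
  obtain rfl : Z' = Z := congrArg Sigma.fst this
  obtain rfl : f = 𝟙 Z' := eq_of_heq (Sigma.mk.inj this).2
  obtain rfl : a' = a := funext fun i => (Category.comp_id _).symm.trans (hf i)
  exact ⟨h0, h1⟩

/-! ### The theory `Θ_s` is homogeneous -/

theorem supp_strictFreeMap {B C : Bat} (i : GlobHom B.glob C.glob) {n : ℕ}
    (x : StrictCell B.glob n) (m : ℕ) :
    StrictCell.supp ((strictFreeMap i).hom.app n x) m = i.app m '' x.supp m :=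
  Set.range_comp (i.app m) (x.map.app m)

theorem strictFreeMap_injective {B C : Bat} (i : GlobHom B.glob C.glob) (n : ℕ) :
    Function.Injective ((strictFreeMap i).hom.app n) := by
  intro x y h
  refine StrictCell.supp_injective (funext fun m => (i.injective m).image_injective ?_)
  exact (supp_strictFreeMap i x m).symm.trans
    ((congrArg (fun z : StrictCell C.glob n => z.supp m) h).trans (supp_strictFreeMap i y m))

instance : inclS.Faithful where
  map_injective {B C f g} h := by
    refine GlobHom.ext (funext fun n => funext fun p => ?_)
    have h' : gen (f.app n p : Pos C n) = gen (g.app n p : Pos C n) :=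
      (GlobHom.gen_app f p).trans ((congrArg (fun F : StrictFunctor (Bat.glob B) (Bat.glob C) =>
        F.hom.app n (gen (p : Pos B n))) h).trans (GlobHom.gen_app g p).symm)
    have := StrictCell.map_app_eq h' (topPos n)
    exact (ofPos_topPos _).symm.trans (this.trans (ofPos_topPos _))

theorem supportData_inclS :
    SupportData inclS (fun {X C} f => StrictFunctor.supp (B := X) (C := C) f) where
  injective_obj _ _ h := h
  surjective_obj X := ⟨X, rfl⟩
  isTree f := StrictFunctor.supp_isTree f
  supp_comp {X B C} g i n := by
    ext w
    constructor
    · rintro ⟨m, p, -, hw⟩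
      obtain ⟨v, hv, rfl⟩ := (supp_strictFreeMap i (StrictFunctor.hom g |>.app m (gen p)) n).subset hw
      exact ⟨v, ⟨m, p, trivial, hv⟩, rfl⟩
    · rintro ⟨v, ⟨m, p, -, hv⟩, rfl⟩
      exact ⟨m, p, trivial, (supp_strictFreeMap i (StrictFunctor.hom g |>.app m (gen p)) n).superset
        ⟨v, hv, rfl⟩⟩
  exists_fac {X B C} f i h := by
    change StrictFunctor (Bat.glob X) (Bat.glob C) at f
    change GlobHom (Bat.glob B) (Bat.glob C) at i
    have hex : ∀ m (p : Pos X m), ∃ y : StrictCell (Bat.glob B) m,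
        (strictFreeMap i).hom.app m y = f.hom.app m (gen p) := by
      intro m p
      have := GlobHom.exists_fac (StrictCell.map (f.hom.app m (gen p))) i i.injective
        fun n q => h n ⟨m, p, trivial, q, rfl⟩
      obtain ⟨g, hg⟩ := this
      exact ⟨⟨_, StrictCell.dim_le (f.hom.app m (gen p)), g⟩,
        StrictCell.ext rfl (heq_of_eq hg)⟩
    choose y hy using hex
    -- The lifted values respect faces because relabelling along `i` is injective on cells.
    let τ : GlobHom (Bat.glob X) (strictFree (Bat.glob B)) :=
      { app := y
        app_src := fun {n} p => strictFreeMap_injective i n <| by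
          refine (hy _ _).trans (((f.genHom).app_src p).trans ?_)
          exact (congrArg _ (hy _ p).symm).trans ((strictFreeMap i).hom.app_src (y _ p)).symm
        app_tgt := fun {n} p => strictFreeMap_injective i n <| by
          refine (hy _ _).trans (((f.genHom).app_tgt p).trans ?_)
          exact (congrArg _ (hy _ p).symm).trans ((strictFreeMap i).hom.app_tgt (y _ p)).symm }
    refine ⟨extend τ, StrictFunctor.ext_gen fun m p => ?_⟩
    exact (congrArg ((strictFreeMap i).hom.app m) (extend_gen τ p)).trans (hy m p)
  cancel {X B C} g g' i h := by
    refine StrictFunctor.ext (GlobHom.ext (funext fun n => funext fun x => ?_))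
    exact strictFreeMap_injective i n
      (congrArg (fun F : StrictFunctor (Bat.glob X) (Bat.glob C) => F.hom.app n x) h)

theorem IsGlobCocone.map {A : Type*} [Category A] (j : Theta0 ⥤ A) {G : DimTable} {Z : Theta0}
    {a : ∀ i : Fin (G.r + 1), Theta0.globe (G.top i) ⟶ Z} (ha : IsGlobCocone (𝟭 Theta0) G Z a) :
    IsGlobCocone j G (j.obj Z) fun i => j.map (a i) := fun i => by
  rw [← j.map_comp, ← j.map_comp]
  exact congrArg j.map (ha i)

theorem isGlobularTheory_inclS : IsGlobularTheory inclS where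
  bijective_obj := ⟨fun _ _ h => h, fun X => ⟨X, rfl⟩⟩
  faithful := inferInstance
  preserves_sums G Z a ha := by
    refine ⟨ha.1.map inclS, fun W b hb => ?_⟩
    have hp := ha.isPosSum.1
    let b' : ∀ i : Fin (G.r + 1), StrictFunctor (globe (G.top i)).glob (Bat.glob W) := b
    -- Equality of strict functors need only be tested on generators.
    have key : ∀ h : inclS.obj Z ⟶ W,
        (∀ i, inclS.map (a i) ≫ h = b i) ↔ ∀ i k (x : Pos (globe (G.top i)) k),
          (StrictFunctor.hom h).app k (gen (a i |>.app k x : Pos Z k)) = (b' i).hom.app k (gen x) := by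
      intro h
      refine forall_congr' fun i => ⟨fun hi k x => ?_, fun hi => StrictFunctor.ext_gen fun k x => ?_⟩
      · rw [← show _ = b' i from hi]
        exact congrArg ((StrictFunctor.hom h).app k) (GlobHom.gen_app (a i) x)
      · exact (congrArg ((StrictFunctor.hom h).app k) (GlobHom.gen_app (a i) x)).symm.trans (hi k x)
    obtain ⟨h, hh⟩ := hp.desc (StrictCell (Bat.glob W)) (fun i k x => (b' i).hom.app k (gen x))
      fun i k z => by
        have h1 := congrArg (fun F : StrictFunctor (globe (G.bot i)).glob (Bat.glob W) =>
          F.hom.app k (gen z)) (hb i)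
        refine Eq.trans ?_ (h1.trans ?_)
        · exact congrArg ((b' i.castSucc).hom.app k) (GlobHom.gen_app (cotgt (G.lt_left i).le) z)
        · exact (congrArg ((b' i.succ).hom.app k)
            (GlobHom.gen_app (cosrc (G.lt_right i).le) z)).symm
    let τ : GlobHom (Bat.glob Z) (strictFree (Bat.glob W)) :=
      { app := h
        app_src := fun {n} p => hp.desc_face (s := fun n x => StrictCell.srcAt n x) false
          (fun i k x => (b' i).genHom.app_src x) hh n p
        app_tgt := fun {n} p => hp.desc_face (s := fun n x => StrictCell.tgtAt n x) true
          (fun i k x => (b' i).genHom.app_tgt x) hh n p }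
    refine ⟨extend τ, (key _).2 fun i k x => (extend_gen τ _).trans (hh i k x), fun g hg => ?_⟩
    refine StrictFunctor.ext_gen fun k p => ?_
    obtain ⟨i, x, rfl⟩ := hp.cover k p
    exact ((key g).1 hg i k x).trans ((extend_gen τ _).trans (hh i k x)).symm

theorem isHomogeneous_inclS : IsHomogeneous inclS where
  isGlobularTheory := isGlobularTheory_inclS
  existsUnique_fac f := supportData_inclS.existsUnique_fac f

/-! ### Supports of cells of the free computad on a tree -/

/-- The support of a raw cell of the free computad on a tree. -/
def RawCell.supp {D : Bat} {n : ℕ} (c : RawCell (Pos D) n) : PosSet D :=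
  fun _ => {w | Computad.InSupport (Computad.free D.glob) w c}

/-- The source (`false`) or target (`true`) of a raw cell of the free computad on a tree. -/
def RawCell.face {D : Bat} : Bool → {n : ℕ} → RawCell (Pos D) (n + 1) → RawCell (Pos D) n
  | false, _, c => (PreComputad.free D.glob).src c
  | true, _, c => (PreComputad.free D.glob).tgt c

theorem RawCell.mem_supp_self {D : Bat} {n : ℕ} (v : Pos D n) :
    v ∈ (RawCell.var v : RawCell (Pos D) n).supp n :=
  Computad.InSupport.self (C := Computad.free D.glob)

theorem RawCell.supp_face_var_subset {D : Bat} {n : ℕ} (v : Pos D (n + 1)) (e : Bool) (l : ℕ) :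
    (RawCell.face e (.var v : RawCell (Pos D) (n + 1))).supp l ⊆
      (.var v : RawCell (Pos D) (n + 1)).supp l := by
  cases e
  · exact fun _ h => Computad.InSupport.src (C := Computad.free D.glob) v h
  · exact fun _ h => Computad.InSupport.tgt (C := Computad.free D.glob) v h

theorem RawCell.mem_supp_coh {D : Bat} {n : ℕ} {B : Bat} {a b : RawCell (Pos B) n}
    {τ : ∀ k : ℕ, Pos B k → RawCell (Pos D) k} {k : ℕ} {w : Pos D k} {m : ℕ} {p : Pos B m}
    (h : w ∈ (τ m p).supp k) : w ∈ (RawCell.coh B a b τ).supp k :=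
  Computad.InSupport.coh (C := Computad.free D.glob) B a b τ m p h

theorem RawCell.supp_induction {D : Bat} {k : ℕ} {w : Pos D k} {P : ∀ n, RawCell (Pos D) n → Prop}
    (self : P k (.var w))
    (face : ∀ (n : ℕ) (v : Pos D (n + 1)) (e : Bool), P n (.var (v.face e)) → P (n + 1) (.var v))
    (coh : ∀ (n : ℕ) (B : Bat) (a b : RawCell (Pos B) n) (τ : ∀ k : ℕ, Pos B k → RawCell (Pos D) k)
      (m : ℕ) (p : Pos B m), P m (τ m p) → P (n + 1) (.coh B a b τ))
    {n : ℕ} {c : RawCell (Pos D) n} (h : w ∈ c.supp k) : P n c :=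
  Computad.InSupport.rec (C := Computad.free D.glob) (motive := fun {n} c _ => P n c) self
    (fun v _ ih => face _ v false ih) (fun v _ ih => face _ v true ih)
    (fun B a b τ m p _ ih => coh _ B a b τ m p ih) h

theorem RawCell.face_mem_supp {D : Bat} {n : ℕ} {c : RawCell (Pos D) n} {m : ℕ} {q : Pos D (m + 1)}
    (h : q ∈ c.supp (m + 1)) (e : Bool) : q.face e ∈ c.supp m := by
  refine RawCell.supp_induction (P := fun n c => q.face e ∈ c.supp m) ?_
    (fun n v e h => ?_) (fun n B a b τ l p h => RawCell.mem_supp_coh h) h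
  · refine RawCell.supp_face_var_subset q e m ?_
    cases e <;> exact RawCell.mem_supp_self _
  · refine RawCell.supp_face_var_subset v e m ?_
    cases e <;> exact h

/-- Both supports are generated from `p` by taking faces. -/
theorem RawCell.supp_var {D : Bat} {n : ℕ} (p : Pos D n) :
    (RawCell.var p : RawCell (Pos D) n).supp = (gen p).supp := by
  ext k w
  constructor
  · intro h
    refine RawCell.supp_induction
      (P := fun n c => ∀ p : Pos D n, c = .var p → w ∈ (gen p).supp k) ?_ ?_ ?_ h p rfl
    · rintro p ⟨⟩
      exact mem_supp_gen w
    · rintro n v e ih p ⟨⟩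
      have := ih _ rfl
      rw [supp_gen_face] at this
      exact this.1
    · rintro n B a b τ m p - q h
      cases h
  · exact supp_gen_induction (P := fun k w => w ∈ (RawCell.var p : RawCell (Pos D) n).supp k)
      (RawCell.mem_supp_self p) fun _ _ h e => RawCell.face_mem_supp h e

theorem RawCell.supp_coh {D : Bat} {n : ℕ} (B : Bat) (a b : RawCell (Pos B) n)
    (τ : ∀ k : ℕ, Pos B k → RawCell (Pos D) k) :
    (RawCell.coh B a b τ).supp = PosSet.bind (fun m p => (τ m p).supp) fun _ => Set.univ := by
  ext k w
  constructor
  · intro h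
    -- The induction predicate ranges over all cells, so the claim about coherences is made by cases
    -- on the cell and is empty on generators.
    refine (RawCell.supp_induction (P := fun n c => w ∈ c.supp k ∧
      match n, c with
      | _, .var _ => True
      | _, .coh _ _ _ τ => ∃ m p, True ∧ w ∈ (τ m p).supp k) ?_ ?_ ?_ h).2
    · exact ⟨RawCell.mem_supp_self w, trivial⟩
    · intro n v e ih
      refine ⟨RawCell.supp_face_var_subset v e k ?_, trivial⟩
      cases e <;> exact ih.1
    · exact fun n B a b τ m p ih => ⟨RawCell.mem_supp_coh ih.1, m, p, trivial, ih.1⟩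
  · rintro ⟨m, p, -, h⟩
    exact RawCell.mem_supp_coh h

theorem RawCell.exists_mem_supp_of_subst {D : Bat} {V : ℕ → Type} {n : ℕ} (c : RawCell V n)
    (σ : ∀ k, V k → RawCell (Pos D) k) {l : ℕ} {w : Pos D l} (h : w ∈ (c.subst σ).supp l) :
    ∃ k v, w ∈ (σ k v).supp l := by
  induction c with
  | var v => exact ⟨_, v, h⟩
  | coh B a b τ _ _ ih =>
    rw [RawCell.subst, RawCell.supp_coh] at h
    obtain ⟨m, p, -, h⟩ := h
    exact ih m p σ h

theorem RawCell.supp_face_subset {D : Bat} {n : ℕ} (c : RawCell (Pos D) (n + 1)) (e : Bool) (l : ℕ) :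
    (c.face e).supp l ⊆ c.supp l := by
  intro w hw
  cases c with
  | var v => exact RawCell.supp_face_var_subset v e l hw
  | coh B a b τ =>
    have : ∃ k v, w ∈ (τ k v).supp l := by
      cases e
      · exact RawCell.exists_mem_supp_of_subst a τ hw
      · exact RawCell.exists_mem_supp_of_subst b τ hw
    obtain ⟨k, v, hv⟩ := this
    exact RawCell.mem_supp_coh hv

/-- The family of generators is an index of `RawCell`, so the equality `V = Pos B` has to be carried
through the induction. -/
theorem RawCell.exists_of_mem_supp_subst {D : Bat} {V : ℕ → Type} {n : ℕ} (c : RawCell V n) :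
    ∀ {B : Bat} (hV : V = Pos B) (σ : ∀ k, Pos B k → RawCell (Pos D) k) {l : ℕ} {w : Pos D l},
      w ∈ ((hV ▸ c : RawCell (Pos B) n).subst σ).supp l →
        w ∈ ((hV ▸ c : RawCell (Pos B) n).supp.bind fun m p => (σ m p).supp) l := by
  induction c with
  | var v =>
    intro B hV σ l w h
    subst hV
    exact ⟨_, v, RawCell.mem_supp_self v, h⟩
  | coh B' a b τ _ _ ih =>
    intro B hV σ l w h
    subst hV
    change w ∈ ((RawCell.coh B' a b τ).subst σ).supp l at h
    rw [RawCell.subst, RawCell.supp_coh] at h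
    obtain ⟨m, p, -, h⟩ := h
    obtain ⟨m', q, hq, hw⟩ := ih m p rfl σ h
    exact ⟨m', q, RawCell.mem_supp_coh hq, hw⟩

/-- Compatibility of `σ` with faces matters because a position may belong to the support of `c` only
as a face of a generator; its image must then be contained in the support of the image of that
generator. -/
theorem RawCell.supp_subst {B D : Bat} {n : ℕ} (c : RawCell (Pos B) n)
    (σ : ∀ k, Pos B k → RawCell (Pos D) k)
    (hσ : ∀ k (p : Pos B (k + 1)) e, (σ (k + 1) p).face e = σ k (p.face e)) :
    (c.subst σ).supp = c.supp.bind fun m p => (σ m p).supp := by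
  ext l w
  refine ⟨RawCell.exists_of_mem_supp_subst c rfl σ, ?_⟩
  rintro ⟨m, p, hp, hw⟩
  refine RawCell.supp_induction (w := p) (P := fun n c => w ∈ (c.subst σ).supp l) hw ?_ ?_ hp
  · intro n v e ih
    refine RawCell.supp_face_subset (σ _ v) e l ?_
    rw [hσ]
    exact ih
  · exact fun n B' a b τ m p ih => RawCell.mem_supp_coh ih

/-! ### Boundaries of cells -/

theorem Computad.hom_face {B D : Bat} (σ : Computad.Hom (Computad.free B.glob) (Computad.free D.glob))
    (k : ℕ) (p : Pos B (k + 1)) (e : Bool) :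
    RawCell.face e (σ.app (k + 1) p) = σ.app k (p.face e) := by
  cases e
  · exact σ.src_app p
  · exact σ.tgt_app p

/-- The homomorphism that a coherence cell is composed with. -/
def cohHom {D B : Bat} (τ : ∀ k : ℕ, Pos B k → RawCell (Pos D) k)
    (cell_app : ∀ (k : ℕ) (p : Pos B k), IsCell (PreComputad.free D.glob) (τ k p))
    (src_app : ∀ (k : ℕ) (p : Pos B (k + 1)),
      (PreComputad.free D.glob).src (τ (k + 1) p) = τ k p.src)
    (tgt_app : ∀ (k : ℕ) (p : Pos B (k + 1)),
      (PreComputad.free D.glob).tgt (τ (k + 1) p) = τ k p.tgt) :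
    Computad.Hom (Computad.free B.glob) (Computad.free D.glob) where
  app := τ
  isCell v := cell_app _ v
  src_app v := src_app _ v
  tgt_app v := tgt_app _ v

theorem IsCell.face {D : Bat} {n : ℕ} {c : RawCell (Pos D) (n + 1)}
    (hc : IsCell (PreComputad.free D.glob) c) (e : Bool) :
    IsCell (PreComputad.free D.glob) (c.face e) := by
  cases hc with
  | var v =>
    cases e
    · exact IsCell.var (C := PreComputad.free D.glob) (D.glob.src v)
    · exact IsCell.var (C := PreComputad.free D.glob) (D.glob.tgt v)
  | coh B a b τ h1 h2 h3 h4 h5 h6 h7 h8 =>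
    cases e
    · exact (cohHom τ h6 h7 h8).isCell_subst h2
    · exact (cohHom τ h6 h7 h8).isCell_subst h3

theorem IsCell.parallel_face {D : Bat} {n : ℕ} {c : RawCell (Pos D) (n + 1)}
    (hc : IsCell (PreComputad.free D.glob) c) :
    (PreComputad.free D.glob).Parallel (c.face false) (c.face true) := by
  cases hc with
  | var v => exact (Computad.free D.glob).parallel v
  | coh B a b τ h1 h2 h3 h4 h5 h6 h7 h8 =>
    cases n with
    | zero => trivial
    | succ n =>
      have hs := fun c : RawCell (Pos B) (n + 1) => (cohHom τ h6 h7 h8).src_subst c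
      have ht := fun c : RawCell (Pos B) (n + 1) => (cohHom τ h6 h7 h8).tgt_subst c
      exact ⟨(hs a).trans ((congrArg (RawCell.subst τ) h4.1).trans (hs b).symm),
        (ht a).trans ((congrArg (RawCell.subst τ) h4.2).trans (ht b).symm)⟩

/-- The cells whose support is a tree that determines the supports of their boundaries. -/
structure RawCell.IsPasting {D : Bat} {n : ℕ} (c : RawCell (Pos D) n) : Prop where
  isTree : c.supp.IsTree
  dim_le : ∀ m p, p ∈ c.supp m → m ≤ n
  fv_eq : c.fv = c.supp n
  supp_face : ∀ (m : ℕ) (h : n = m + 1) (e : Bool),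
    (RawCell.face e (h ▸ c : RawCell (Pos D) (m + 1))).supp = c.supp.bd e m

theorem bdry_zero_unique : ∀ (e : Bool) {B : Bat} {p q : Pos B 0}, p ∈ bdry e B 0 → q ∈ bdry e B 0 →
    p = q
  | false, B, p, q, hp, hq => by
    have key : ∀ p : Pos B 0, p ∈ bdry false B 0 → p = .here := fun p hp => by
      rcases p.eq_here_or_tgt with h | ⟨r, hr⟩
      · exact h
      · exact absurd hr (hp r)
    rw [key p hp, key q hq]
  | true, .nil, .here, .here, _, _ => rfl
  | true, .cons _ _, .here, _, hp, _ => absurd hp here_notMem_bdry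
  | true, .cons _ _, _, .here, _, hq => absurd hq here_notMem_bdry
  | true, .cons _ _, .inr p, .inr q, hp, hq =>
    congrArg Pos.inr (bdry_zero_unique true (inr_zero_mem_bdry.1 hp) (inr_zero_mem_bdry.1 hq))

/-- The delicate positions are those of dimension `n` outside `bdry e`. Each is a face of some `q`,
and `q` is parallel to a position of the `e`-boundary, which lies in `U`; closure under faces
concludes. -/
theorem PosSet.eq_bd_univ {B : Bat} {U : PosSet B} (hU : U.IsTree) {n : ℕ} {e : Bool}
    (hd : ∀ m p, p ∈ U m → m ≤ n + 1) (ht : U (n + 1) = bdry e B (n + 1))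
    (hb : U.bd e n = PosSet.bd e n fun _ => Set.univ) :
    U = PosSet.bd e (n + 1) fun _ => Set.univ := by
  have hb' : ∀ m p, p ∈ PosSet.bd (B := B) e n (fun _ => Set.univ) m → p ∈ U m := fun m p hp => by
    rw [← hb] at hp
    exact hp.1
  ext m p
  constructor
  · intro hp
    refine ⟨trivial, hd m p hp, ?_⟩
    rintro rfl q - hq
    rw [ht] at hp
    exact hp q hq
  · rintro ⟨-, hm, h⟩
    rcases hm.eq_or_lt with rfl | hm
    · rw [ht]
      exact fun q => h rfl q trivial
    · rcases (Nat.lt_succ_iff.1 hm).eq_or_lt with rfl | hm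
      · by_cases hp : p ∈ bdry e B m
        · exact hb' m p ⟨trivial, le_rfl, fun _ q _ => hp q⟩
        · obtain ⟨q, rfl⟩ : ∃ q : Pos B (m + 1), q.face (!e) = p := by
            by_contra hq
            exact hp fun q hqp => hq ⟨q, hqp⟩
          obtain ⟨r, hr, hrq⟩ := exists_parallel_mem_bdry e q
          rw [← hrq]
          exact hU.face_mem _ (ht ▸ hr)
      · exact hb' m p ⟨trivial, hm.le, fun h => absurd h hm.ne⟩

/-- Fullness prescribes only the supports in the top dimension at each level; the lower positions
are recovered inductively from the boundary sphere. -/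
theorem IsFull.supp_eq {B : Bat} : ∀ {n : ℕ} {a b : RawCell (Pos B) n},
    (∀ m ≤ n, ∀ c : RawCell (Pos B) m, IsCell (PreComputad.free B.glob) c → c.IsPasting) →
    IsCell (PreComputad.free B.glob) a → IsCell (PreComputad.free B.glob) b →
    (PreComputad.free B.glob).Parallel a b → IsFull B n a b →
      a.supp = PosSet.bd false n (fun _ => Set.univ) ∧ b.supp = PosSet.bd true n fun _ => Set.univ
  | 0, a, b, H, ha, hb, _, hf => by
    have key : ∀ (e : Bool) (c : RawCell (Pos B) 0), IsCell (PreComputad.free B.glob) c →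
        c.fv ⊆ bdry e B 0 → c.supp = PosSet.bd e 0 fun _ => Set.univ := by
      intro e c hc hfv
      have hP := H 0 le_rfl c hc
      cases c with
      | var v =>
        have hv : v ∈ bdry e B 0 := hfv rfl
        ext m p
        constructor
        · intro hp
          obtain rfl : m = 0 := Nat.le_zero.1 (hP.dim_le m p hp)
          rw [← hP.fv_eq] at hp
          obtain rfl : p = v := hp
          exact ⟨trivial, le_rfl, fun _ q _ => hv q⟩
        · rintro ⟨-, hm, h⟩
          obtain rfl : m = 0 := Nat.le_zero.1 hm
          rw [bdry_zero_unique e (p := p) (fun q => h rfl q trivial) hv]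
          exact .self
    exact ⟨key false a ha (srcBoundary_eq B 0 ▸ hf.1), key true b hb (tgtBoundary_eq B 0 ▸ hf.2)⟩
  | n + 1, a, b, H, ha, hb, hab, hf => by
    obtain ⟨h1, h2⟩ := IsFull.supp_eq (fun m hm => H m (hm.trans (Nat.le_succ n)))
      (ha.face false) (ha.face true) ha.parallel_face hf.2.2
    have hA := H _ le_rfl a ha
    have hB := H _ le_rfl b hb
    refine ⟨PosSet.eq_bd_univ hA.isTree hA.dim_le ?_ ?_, PosSet.eq_bd_univ hB.isTree hB.dim_le ?_ ?_⟩
    · rw [← hA.fv_eq, hf.1, srcBoundary_eq]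
    · rw [← hA.supp_face n rfl false]
      exact h1
    · rw [← hB.fv_eq, hf.2.1, tgtBoundary_eq]
    · rw [← hB.supp_face n rfl true]
      -- `IsFull` records the boundary sphere of `a` only; parallelism transfers its target to `b`.
      exact (congrArg RawCell.supp hab.2.symm).trans h2

theorem RawCell.isPasting_var {D : Bat} {n : ℕ} (v : Pos D n) :
    (RawCell.var v : RawCell (Pos D) n).IsPasting where
  isTree := by
    rw [RawCell.supp_var]
    exact (gen v).supp_isTree
  dim_le := by
    rw [RawCell.supp_var]
    exact (gen v).le_of_mem_supp
  fv_eq := by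
    rw [RawCell.supp_var]
    ext w
    constructor
    · rintro rfl
      exact mem_supp_gen w
    · rintro ⟨q, rfl⟩
      rw [eq_topPos q]
      exact ofPos_topPos v
  supp_face := by
    rintro m rfl e
    rw [RawCell.supp_var, ← supp_gen_face, ← RawCell.supp_var]
    cases e <;> rfl

section

variable {B D : Bat} (τ : ∀ k : ℕ, Pos B k → RawCell (Pos D) k)
  (hτ : ∀ k p, (τ k p).IsPasting)
  (hf : ∀ k (p : Pos B (k + 1)) e, (τ (k + 1) p).face e = τ k (p.face e))

-- Each value of `τ` has the support of a strict cell of the same dimension. These strict cells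
-- respect faces because their supports do.
include hτ hf in
theorem exists_globHom_supp : ∃ σ : GlobHom B.glob (strictFree D.glob),
    σ.suppMap = fun m p => (τ m p).supp := by
  choose x hx using fun k (p : Pos B k) =>
    StrictCell.exists_supp_eq (n := k) (hτ k p).isTree (hτ k p).dim_le
  have key : ∀ k (p : Pos B (k + 1)) e, x k (p.face e) = (x (k + 1) p).bdAt e k := by
    intro k p e
    refine StrictCell.supp_injective ?_
    rw [StrictCell.supp_bdAt, hx, hx, ← hf, ← (hτ (k + 1) p).supp_face k rfl e]
  exact ⟨⟨x, fun p => key _ p false, fun p => key _ p true⟩,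
    funext fun m => funext fun p => hx m p⟩

-- The coherence has the same support as the strict cell obtained by extending the supports of `τ`
-- and evaluating at the top cell of `B`. Boundaries of that strict cell are unions over the
-- boundaries of `B`, which are the supports of `a` and `b`.
include hτ hf in
theorem RawCell.isPasting_coh {n : ℕ} {a b : RawCell (Pos B) n} (hB : B.dim ≤ n + 1)
    (ha : a.supp = PosSet.bd false n fun _ => Set.univ)
    (hb : b.supp = PosSet.bd true n fun _ => Set.univ) :
    (RawCell.coh B a b τ).IsPasting := by
  obtain ⟨σ, hσ⟩ := exists_globHom_supp τ hτ hf
  have hy : (extendApp σ (topCell B hB)).supp = (RawCell.coh B a b τ).supp := by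
    rw [supp_extendApp, supp_topCell, hσ, RawCell.supp_coh]
  refine ⟨hy ▸ StrictCell.supp_isTree _, hy ▸ StrictCell.le_of_mem_supp _, ?_, ?_⟩
  · rw [RawCell.supp_coh]
    ext w
    constructor
    · intro hw
      obtain ⟨p, hp⟩ := Set.mem_iUnion.1 hw
      exact ⟨_, p, trivial, (hτ _ p).fv_eq.subset hp⟩
    · rintro ⟨m, p, -, hw⟩
      -- The height of `B` bounds `m` above, and the dimension of `w` bounds it below.
      obtain rfl : m = n + 1 := le_antisymm (p.dim_le.trans hB) ((hτ m p).dim_le _ _ hw)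
      exact Set.mem_iUnion.2 ⟨p, (hτ _ p).fv_eq.superset hw⟩
  · rintro m hm e
    obtain rfl : n = m := Nat.succ.inj hm
    have hs : ∀ c : RawCell (Pos B) n, c.supp = PosSet.bd e n (fun _ => Set.univ) →
        (c.subst τ).supp = (RawCell.coh B a b τ).supp.bd e n := by
      intro c hc
      rw [RawCell.supp_subst c τ hf, ← hy, bd_extendApp, supp_topCell, hσ, hc]
    cases e
    · exact hs a ha
    · exact hs b hb

end

/-- Two inductions are nested. The values of `τ` can have the same dimension as the coherence but
are structurally smaller. The sphere `(a, b)` is handled by dimension instead, through `H`, because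
`IsFull.supp_eq` also needs the iterated faces of `a` and `b`, which need not be subterms. -/
theorem IsCell.isPasting_aux {N : ℕ}
    (H : ∀ m < N, ∀ (D : Bat) (c : RawCell (Pos D) m), IsCell (PreComputad.free D.glob) c →
      c.IsPasting) {P : PreComputad} {n : ℕ} {c : RawCell P.V n} (hc : IsCell P c) :
    ∀ {D : Bat} (h : PreComputad.free D.glob = P), n ≤ N →
      RawCell.IsPasting (D := D) (h ▸ c : RawCell (PreComputad.free D.glob).V n) := by
  induction hc with
  | var v =>
    intro D h _
    subst h
    exact RawCell.isPasting_var v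
  | @coh _ n B a b τ h1 h2 h3 h4 h5 h6 h7 h8 _ _ ih =>
    intro D h hn
    subst h
    have hτ : ∀ k p, RawCell.IsPasting (D := D) (τ k p) := fun k p =>
      ih k p rfl ((p.dim_le.trans h1).trans hn)
    have hf := Computad.hom_face (cohHom τ h6 h7 h8)
    obtain ⟨ha, hb⟩ := IsFull.supp_eq (fun m hm => H m (by omega) B) h2 h3 h4 h5
    exact RawCell.isPasting_coh τ hτ hf h1 ha hb

theorem IsCell.isPasting {n : ℕ} : ∀ {D : Bat} {c : RawCell (Pos D) n},
    IsCell (PreComputad.free D.glob) c → c.IsPasting := by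
  induction n using Nat.strong_induction_on with
  | _ n ih => exact fun hc => IsCell.isPasting_aux (fun m hm D c => ih m hm) hc rfl le_rfl

/-! ### The functor from `Θ_w` to `Θ_s` -/

section

variable {B D : Bat} (f : Computad.Hom (Computad.free B.glob) (Computad.free D.glob))

/-- The strict cells with the same supports as the values of a homomorphism of computads. -/
noncomputable def strictHom : GlobHom B.glob (strictFree D.glob) :=
  (exists_globHom_supp f.app (fun _ p => (f.isCell p).isPasting) (Computad.hom_face f)).choose

theorem suppMap_strictHom : (strictHom f).suppMap = fun m p => (f.app m p).supp :=
  (exists_globHom_supp f.app (fun _ p => (f.isCell p).isPasting) (Computad.hom_face f)).choose_spec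

theorem supp_strictHom {m : ℕ} (p : Pos B m) :
    StrictCell.supp ((strictHom f).app m p) = (f.app m p).supp :=
  congrFun (congrFun (suppMap_strictHom f) m) p

/-- The support of a homomorphism of computads. -/
def homSupp : PosSet D := PosSet.bind (fun m p => (f.app m p).supp) fun _ => Set.univ

theorem supp_extend_strictHom : (extend (strictHom f)).supp = homSupp f := by
  have : (extend (strictHom f)).genHom.suppMap = fun m p => (f.app m p).supp :=
    (funext fun m => funext fun p => congrArg StrictCell.supp (extend_gen (strictHom f) p)).trans
      (suppMap_strictHom f)
  exact congrArg (fun τ => PosSet.bind τ fun _ => Set.univ) this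

theorem hasFullSupport_iff : f.HasFullSupport ↔ ∀ n p, p ∈ homSupp f n := by
  refine forall_congr' fun n => forall_congr' fun p => exists_congr fun m => exists_congr fun v => ?_
  exact ⟨fun h => ⟨trivial, h⟩, fun h => h.2⟩

end

/-- The functor from `Θ_w` to `Θ_s`. -/
noncomputable def strictify : ThetaW ⥤ ThetaS where
  obj B := B
  map {B C} f := extend (B := B) (C := C) (strictHom f)
  map_id B := by
    refine StrictFunctor.ext_gen fun m p => (extend_gen _ p).trans (StrictCell.supp_injective ?_)
    exact (supp_strictHom (B := B) (D := B) _ p).trans (RawCell.supp_var _)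
  map_comp {B C D} f g := by
    refine StrictFunctor.ext_gen fun m p => (extend_gen _ p).trans (StrictCell.supp_injective ?_)
    refine (supp_strictHom (B := B) (D := D) _ p).trans ?_
    refine (RawCell.supp_subst _ _ (Computad.hom_face g)).trans ?_
    refine Eq.trans ?_ (congrArg (fun x : StrictCell (Bat.glob C) m =>
      (extendApp (strictHom g) x).supp) (extend_gen (strictHom f) p)).symm
    refine Eq.trans ?_ (supp_extendApp (strictHom g) _).symm
    exact congrArg₂ PosSet.bind (suppMap_strictHom g).symm (supp_strictHom f p).symm

theorem inclW_comp_strictify : inclW ⋙ strictify = inclS := by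
  refine CategoryTheory.Functor.hext (fun _ => rfl) fun B C f => heq_of_eq ?_
  refine StrictFunctor.ext_gen fun m p => (extend_gen _ p).trans (StrictCell.supp_injective ?_)
  refine (supp_strictHom (B := B) (D := C) _ p).trans ((RawCell.supp_var _).trans ?_)
  exact congrArg StrictCell.supp (GlobHom.gen_app f p)

/-! ### The theory `Θ_w` is homogeneous -/

theorem RawCell.rename_injective {V W : ℕ → Type} {f : ∀ k, V k → W k}
    (hf : ∀ k, Function.Injective (f k)) {n : ℕ} (c : RawCell V n) : ∀ c' : RawCell V n,
    c.subst (fun k v => .var (f k v)) = c'.subst (fun k v => .var (f k v)) → c = c' := by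
  induction c with
  | var v =>
    intro c' h
    cases c' with
    | var v' =>
      simp only [RawCell.subst, RawCell.var.injEq] at h
      rw [hf _ h]
    | coh B a b τ => cases h
  | coh B a b τ _ _ ih =>
    intro c' h
    cases c' with
    | var v' => cases h
    | coh B' a' b' τ' =>
      simp only [RawCell.subst, RawCell.coh.injEq] at h
      obtain ⟨rfl, h1, h2, h3⟩ := h
      obtain rfl := eq_of_heq h1
      obtain rfl := eq_of_heq h2
      have : τ = τ' := funext fun k => funext fun p =>
        ih k p hf _ (congrFun (congrFun (eq_of_heq h3) k) p)
      rw [this]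

theorem RawCell.supp_rename {B C : Bat} (i : GlobHom B.glob C.glob) {n : ℕ}
    (c : RawCell (Pos B) n) (m : ℕ) :
    RawCell.supp (D := C) (c.subst (Computad.freeMap i).app) m = i.app m '' c.supp m := by
  refine (congrFun (RawCell.supp_subst c _ (Computad.hom_face (Computad.freeMap i))) m).trans ?_
  have key : ∀ k (p : Pos B k), RawCell.supp (D := C) ((Computad.freeMap i).app k p) m =
      i.app m '' (gen p).supp m := fun k p => by
    rw [← supp_strictFreeMap, ← GlobHom.gen_app]
    exact congrFun (RawCell.supp_var _) m
  ext w
  constructor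
  · rintro ⟨k, p, hp, hw⟩
    obtain ⟨v, hv, rfl⟩ := (key k p).subset hw
    exact ⟨v, supp_gen_induction (P := fun n q => q ∈ c.supp n) hp
      (fun _ _ h e => RawCell.face_mem_supp h e) hv, rfl⟩
  · rintro ⟨v, hv, rfl⟩
    exact ⟨m, v, hv, (key m v).superset ⟨v, mem_supp_gen v, rfl⟩⟩

/-- For a coherence only the values of `τ` have to be lifted, since the sphere lives over its own
tree. Injectivity of renaming makes the lifted values compatible with boundaries. -/
theorem IsCell.exists_rename {P : PreComputad} {n : ℕ} {c : RawCell P.V n} (hc : IsCell P c) :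
    ∀ {B C : Bat} (h : PreComputad.free C.glob = P) (i : GlobHom B.glob C.glob),
      (∀ m, RawCell.supp (D := C) (h ▸ c : RawCell (PreComputad.free C.glob).V n) m ⊆
        Set.range (i.app m)) →
      ∃ c' : RawCell (Pos B) n, IsCell (PreComputad.free B.glob) c' ∧
        c'.subst (Computad.freeMap i).app = (h ▸ c : RawCell (PreComputad.free C.glob).V n) := by
  induction hc with
  | var v =>
    intro B C h i hi
    subst h
    obtain ⟨p, rfl⟩ := hi _ (RawCell.mem_supp_self v)
    exact ⟨.var p, IsCell.var (C := PreComputad.free B.glob) p, rfl⟩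
  | coh A a b τ h1 h2 h3 h4 h5 h6 h7 h8 _ _ ih =>
    intro B C h i hi
    subst h
    choose τ' hτ' hτ using fun k p => ih k p rfl i fun m w hw => hi m (RawCell.mem_supp_coh hw)
    have hinj := fun k => RawCell.rename_injective (n := k) i.injective
    refine ⟨.coh A a b τ', IsCell.coh (C := PreComputad.free B.glob) A a b τ' h1 h2 h3 h4 h5 hτ'
      (fun k p => hinj _ _ _ ?_) (fun k p => hinj _ _ _ ?_), ?_⟩
    · refine ((Computad.freeMap i).src_subst (τ' (k + 1) p)).symm.trans ?_
      exact ((congrArg _ (hτ _ p)).trans (h7 k p)).trans (hτ k _).symm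
    · refine ((Computad.freeMap i).tgt_subst (τ' (k + 1) p)).symm.trans ?_
      exact ((congrArg _ (hτ _ p)).trans (h8 k p)).trans (hτ k _).symm
    · exact congrArg (RawCell.coh A a b) (funext fun k => funext fun p => hτ k p)

instance : inclW.Faithful where
  map_injective {B C f g} h := by
    refine GlobHom.ext (funext fun n => funext fun p => ?_)
    exact RawCell.var.inj (congrFun (congrFun (congrArg Computad.Hom.app h) n) p)

theorem supportData_inclW :
    SupportData inclW (fun {X C} f => homSupp (B := X) (D := C) f) where
  injective_obj _ _ h := h
  surjective_obj X := ⟨X, rfl⟩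
  isTree {X C} f := (supp_extend_strictHom (B := X) (D := C) f).subst
    (motive := PosSet.IsTree) (StrictFunctor.supp_isTree _)
  supp_comp {X B C} g i n := by
    have key := fun m p => RawCell.supp_rename (B := B) (C := C) i (Computad.Hom.app g m p) n
    ext w
    constructor
    · rintro ⟨m, p, -, hw⟩
      obtain ⟨v, hv, rfl⟩ := (key m p).subset hw
      exact ⟨v, ⟨m, p, trivial, hv⟩, rfl⟩
    · rintro ⟨v, ⟨m, p, -, hv⟩, rfl⟩
      exact ⟨m, p, trivial, (key m p).superset ⟨v, hv, rfl⟩⟩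
  exists_fac {X B C} f i h := by
    change Computad.Hom (Computad.free (Bat.glob X)) (Computad.free (Bat.glob C)) at f
    change GlobHom (Bat.glob B) (Bat.glob C) at i
    choose g hg hgf using fun m (p : Pos X m) => (f.isCell p).exists_rename rfl i
      fun n w hw => h n ⟨m, p, trivial, hw⟩
    have hinj := fun k => RawCell.rename_injective (n := k) i.injective
    refine ⟨⟨g, fun {n} p => hg n p, fun {n} p => hinj _ _ _ ?_, fun {n} p => hinj _ _ _ ?_⟩,
      Computad.Hom.ext (funext fun m => funext fun p => hgf m p)⟩
    · refine ((Computad.freeMap i).src_subst (g (n + 1) p)).symm.trans ?_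
      exact ((congrArg _ (hgf _ p)).trans (f.src_app p)).trans (hgf n _).symm
    · refine ((Computad.freeMap i).tgt_subst (g (n + 1) p)).symm.trans ?_
      exact ((congrArg _ (hgf _ p)).trans (f.tgt_app p)).trans (hgf n _).symm
  cancel {X B C} g g' i h := by
    refine Computad.Hom.ext (funext fun n => funext fun p => ?_)
    exact RawCell.rename_injective (GlobHom.injective i) _ _
      (congrFun (congrFun (congrArg Computad.Hom.app h) n) p)

theorem isGlobularTheory_inclW : IsGlobularTheory inclW where
  bijective_obj := ⟨fun _ _ h => h, fun X => ⟨X, rfl⟩⟩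
  faithful := inferInstance
  preserves_sums G Z a ha := by
    refine ⟨ha.1.map inclW, fun W b hb => ?_⟩
    have hp := ha.isPosSum.2
    let b' : ∀ i : Fin (G.r + 1), Computad.Hom (Computad.free (globe (G.top i)).glob)
      (Computad.free (Bat.glob W)) := b
    obtain ⟨h, hh⟩ := hp.desc (RawCell (Pos W)) (fun i => (b' i).app)
      fun i k z => congrFun (congrFun (congrArg Computad.Hom.app (hb i)) k) z
    have hsrc := hp.desc_face (W := RawCell (Pos W)) (b := fun i => (b' i).app) (h := h)
      (s := fun n c => (PreComputad.free (Bat.glob W)).src c) false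
      (fun i k x => ((b' i).src_app x).symm) hh
    have htgt := hp.desc_face (W := RawCell (Pos W)) (b := fun i => (b' i).app) (h := h)
      (s := fun n c => (PreComputad.free (Bat.glob W)).tgt c) true
      (fun i k x => ((b' i).tgt_app x).symm) hh
    have hc : ∀ {n : ℕ} (v : Pos Z n), IsCell (PreComputad.free (Bat.glob W)) (h n v) := by
      intro n v
      obtain ⟨i, x, rfl⟩ := hp.cover n v
      rw [hh]
      exact (b' i).isCell x
    refine ⟨⟨h, hc, fun {n} v => (hsrc n v).symm, fun {n} v => (htgt n v).symm⟩,
      fun i => Computad.Hom.ext (funext fun k => funext fun x => hh i k x), fun g hg => ?_⟩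
    refine Computad.Hom.ext (funext fun k => funext fun p => ?_)
    obtain ⟨i, x, rfl⟩ := hp.cover k p
    exact (congrFun (congrFun (congrArg Computad.Hom.app (hg i)) k) x).trans (hh i k x).symm

theorem isHomogeneous_inclW : IsHomogeneous inclW where
  isGlobularTheory := isGlobularTheory_inclW
  existsUnique_fac f := supportData_inclW.existsUnique_fac f

theorem isCover_inclW_iff {B C : ThetaW} (f : B ⟶ C) :
    IsCover inclW f ↔ Computad.Hom.HasFullSupport f :=
  (supportData_inclW.isCover_iff (C := C) f).trans (hasFullSupport_iff (B := B) (D := C) f).symm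

/-- In both theories covers are the morphisms of full support, and `strictify` keeps supports. -/
theorem isCover_strictify_iff {B C : ThetaW} (f : B ⟶ C) :
    IsCover inclW f ↔ IsCover inclS (strictify.map f) := by
  refine (supportData_inclW.isCover_iff (C := C) f).trans (Iff.trans ?_
    (supportData_inclS.isCover_iff (X := B) (C := C) (strictify.map f)).symm)
  exact iff_of_eq (congrArg (fun U : PosSet C => ∀ n p, p ∈ U n)
    (supp_extend_strictHom (B := B) (D := C) f).symm)

end GlobTheory

theorem mainTheorem12 :
    -- the globular theory of weak `ω`-categories is homogeneous
    GlobTheory.IsHomogeneous GlobTheory.inclW ∧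
    -- its covers are the homomorphisms whose support is everything
    (∀ (B C : GlobTheory.ThetaW) (f : B ⟶ C),
      GlobTheory.IsCover GlobTheory.inclW f ↔ GlobTheory.Computad.Hom.HasFullSupport f) ∧
    -- it is homogeneous over the homogeneous globular theory of strict `ω`-categories
    GlobTheory.IsHomogeneous GlobTheory.inclS ∧
    ∃ S : GlobTheory.ThetaW ⥤ GlobTheory.ThetaS,
      GlobTheory.inclW ⋙ S = GlobTheory.inclS ∧
      ∀ (B C : GlobTheory.ThetaW) (f : B ⟶ C),
        GlobTheory.IsCover GlobTheory.inclW f ↔ GlobTheory.IsCover GlobTheory.inclS (S.map f) :=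
  ⟨GlobTheory.isHomogeneous_inclW, fun _ _ f => GlobTheory.isCover_inclW_iff f,
    GlobTheory.isHomogeneous_inclS, GlobTheory.strictify, GlobTheory.inclW_comp_strictify,
    fun _ _ f => GlobTheory.isCover_strictify_iff f⟩
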